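/- For $0<\varepsilon<\frac1{2\pi}$ put $N_0=1$, $N_{k+1}=\lfloor 5N_k^2/\varepsilon\rfloor$ for $k\ge 0$, and $$\Gamma_\varepsilon=\Big\{u\in\mathbb R/\mathbb Z:\ \inf_{m\in\mathbb Z}|uN_k-m|\le \tfrac{\varepsilon}{N_k}\ \text{ for all } k\ge 1\Big\}.$$ An invertible measure preserving transformation $T$ of a probability space $(X,\mu)$ is called weakly mixing if $T\times T$ is ergodic for $\mu\times\mu$. We write $T^mf=f\circ T^m$ for $m\in\mathbb Z$. The spectral measure of a real $f\in L^2(\mu)$ is the finite Borel measure $\sigma$ on $\mathbb R/\mathbb Z$ with $\int (T^nf)\,f\,d\mu=\int e^{2\pi i nu}\,d\sigma(u)$ for all $n\in\mathbb Z$. A set is called Cantor-like if it is nonempty, compact, perfect and totally disconnected. (a) For every $0<\varepsilon<\frac1{2\pi}$ there are a standard Borel probability space $(X,\mu)$ and a weakly mixing invertible measure preserving transformation $T$ of it such that: (i) there are a Cantor-like set $K\subset\Gamma_\varepsilon$ and a real $f\in L^2(\mu)$ with $\int f\,d\mu=0$, whose spectral measure is a non-atomic probability measure with $\sigma(K^c)=0$,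 such that the averages $\frac1N\sum_{n=1}^N T^{nN}f$ do not converge in $L^2(\mu)$ as $N\to\infty$ (to any limit; in particular, not to $0$); (ii) there is also a bounded measurable real $f$ with $\int f\,d\mu=0$ such that $\frac1N\sum_{n=1}^N T^{nN}f$ do not converge in $L^2(\mu)$ as $N\to\infty$. (b) Consequently, weak mixing does not suffice for $L^2$ convergence of polynomial averages, even for one function: it is not true that, for every weakly mixing invertible transformation $T$ of a standard Borel probability space, every polynomial $P(n,N)$ taking integer values on integers and depending nontrivially on $n$, and every bounded measurable $f$, the averages $\frac1N\sum_{n=1}^N T^{P(n,N)}f$ converge in $L^2$ as $N\to\infty$. -/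

import Mathlib

open MeasureTheory Filter Topology

noncomputable section

/-- An invertible measure-preserving transformation `T` of `(X, μ)` is weakly mixing:
`T × T` is ergodic with respect to `μ × μ`. -/
def IsWeaklyMixing {X : Type*} [MeasurableSpace X] (T : X ≃ᵐ X) (μ : Measure X) : Prop :=
  MeasurePreserving T μ μ ∧ Ergodic (Prod.map T T) (μ.prod μ)

/-- The average `(1/N) ∑_{n=1}^N T^{p(n,N)} f`, where `(T^m f)(x) = f (T^m x)` for `m ∈ ℤ`. -/
def arrayAverage {X : Type*} [MeasurableSpace X] (T : X ≃ᵐ X) (p : ℤ → ℤ → ℤ) (f : X → ℝ)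
    (N : ℕ) (x : X) : ℝ :=
  (1 / (N : ℝ)) * ∑ n ∈ Finset.Icc 1 N, f ((T.toEquiv ^ (p n N) : Equiv.Perm X) x)

/-- `F N` converges in `L²(μ)` to some element of `L²(μ)`. -/
def ConvergesInL2 {X : Type*} [MeasurableSpace X] (μ : Measure X) (F : ℕ → X → ℝ) : Prop :=
  ∃ g : X → ℝ, MemLp g 2 μ ∧ Tendsto (fun N => eLpNorm (F N - g) 2 μ) atTop (𝓝 0)

/-- `σ` is the spectral measure of `f ∈ L²(μ)` with respect to the Koopman operator
`U f = f ∘ T`: the (unique) finite Borel measure on the circle `ℝ/ℤ` with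
`⟨Uⁿ f, f⟩ = ∫ e^{2πinu} dσ(u)` for all `n ∈ ℤ`. -/
def IsSpectralMeasure {X : Type*} [MeasurableSpace X] (T : X ≃ᵐ X) (μ : Measure X) (f : X → ℝ)
    (σ : Measure UnitAddCircle) : Prop :=
  IsFiniteMeasure σ ∧ ∀ n : ℤ,
    ∫ u, fourier n u ∂σ = ((∫ x, f ((T.toEquiv ^ n : Equiv.Perm X) x) * f x ∂μ : ℝ) : ℂ)

/-- A Cantor-like set: nonempty, compact, perfect and totally disconnected. -/
def IsCantorLike {Y : Type*} [TopologicalSpace Y] (K : Set Y) : Prop :=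
  K.Nonempty ∧ IsCompact K ∧ Perfect K ∧ IsTotallyDisconnected K

/-- `N_0 = 1` and `N_{k+1} = [5 N_k² / ε]`. -/
def scaleSeq (ε : ℝ) : ℕ → ℕ
  | 0 => 1
  | k + 1 => ⌊5 * (scaleSeq ε k : ℝ) ^ 2 / ε⌋₊

/-- The set `Γ_ε` of all `u ∈ ℝ/ℤ` whose multiple `N_k u` is, for every `k ≥ 1`, at distance
at most `ε / N_k` from the nearest integer (this distance is the norm on `ℝ/ℤ`). -/
def gammaSet (ε : ℝ) : Set UnitAddCircle :=
  {u | ∀ k : ℕ, 1 ≤ k → ‖scaleSeq ε k • u‖ ≤ ε / (scaleSeq ε k : ℝ)}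

/-- `p` is given by a polynomial in `(n, N)` taking integer values on integers. -/
def IsIntegerValuedPolynomial (p : ℤ → ℤ → ℤ) : Prop :=
  ∃ Q : MvPolynomial (Fin 2) ℝ, ∀ n N : ℤ, (p n N : ℝ) = MvPolynomial.eval ![(n : ℝ), (N : ℝ)] Q

/-- `p(n, N)` depends nontrivially on `n`. -/
def DependsOnFirst (p : ℤ → ℤ → ℤ) : Prop :=
  ∃ a b N : ℤ, p a N ≠ p b N

/-- The assertion that weak mixing suffices for the `L²` convergence of the polynomial averages
`(1/N) ∑_{n=1}^N T^{p(n,N)} f`: for every weakly mixing invertible `T`, every integer-valued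
polynomial `p(n,N)` depending nontrivially on `n`, and every bounded measurable `f`. -/
def WeakMixingSufficesForPolynomials : Prop :=
  ∀ (X : Type) (_ : MeasurableSpace X) (_ : StandardBorelSpace X) (μ : Measure X)
    (_ : IsProbabilityMeasure μ) (T : X ≃ᵐ X), IsWeaklyMixing T μ →
    ∀ p : ℤ → ℤ → ℤ, IsIntegerValuedPolynomial p → DependsOnFirst p →
    ∀ f : X → ℝ, Measurable f → (∃ C : ℝ, ∀ x, |f x| ≤ C) →
      ConvergesInL2 μ (arrayAverage T p f)

end

/-!
The system is a stationary Gaussian process, and the averages along `n N` are controlled on the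
spectral side.

A point `u` of `Γ_ε` has `N_k u` within `ε / N_k` of an integer, so every `n N_k u` with `n ≤ N_k`
is within `ε` of an integer, and the multiplier `φ_N(u) = (1/N) ∑_{n ≤ N} e^{2πi n N u}` stays
within `2πε < 1` of `1` for `N = N_k` (`norm_charAverage_sub_one_le`). On the other hand, for
`u ≠ 0` at least one of `N u` and `(N+1) u` keeps a fixed distance from the integers, and the geometric sum for
that one is bounded; hence `φ_N φ_{N+1} → 0` pointwise away from `0`
(`tendsto_charAverage_mul_succ`). For a probability measure `ν` without atoms on `Γ_ε` these two
facts contradict each other if `φ_N` is Cauchy in `L¹(ν)` (`not_cauchy_charAverage`).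

Such a measure lives on a Cantor subset of `Γ_ε`: since `N_{k+1}` is about `5 N_k² / ε`, the
interval of radius `ε / N_k²` around a multiple of `1 / N_k` contains several multiples of
`1 / N_{k+1}`, and choosing between two neighbours at every step gives an embedding of the Cantor space. Adding the
reflected points makes the set, and an average of two measures, symmetric
(`exists_symmetric_measure_on_cantorLike`).

The Gaussian measure on `ℤ → ℝ` with covariance `∫ cos (2π (i - j) u) dν(u)` is the joint law of the
characters under an isonormal process over `L²(ν; ℂ)` (`exists_gaussian_measure`). Its zeroth
coordinate has spectral measure `ν`, and `L²` norms of linear combinations of coordinates are norms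
of trigonometric polynomials in `L²(ν)`, so its averages diverge. By Wiener's lemma the Fourier
coefficients of `ν`, with all translates, tend to zero along some sequence of times
(`exists_tendsto_integral_fourier`), so characters of `T × T` decorrelate along it. These characters
determine finite measures, and this makes `T × T` ergodic (`ergodic_of_tendsto_correlation`,
`isWeaklyMixing_intShift`).

Finally, the averages are contractions of `L²`, so if they converged for all bounded functions they
would converge for all of `L²` (`exists_bounded_not_convergesInL2`). The same bounded function
refutes the statement about all polynomials, through `P(n, N) = n N`.
-/

/-! ### A symmetric Cantor set inside `Γ_ε` -/

/-- Since `ε < 1/6`, rounding down costs less than `N_k² / ε`; the remaining factor `4` is what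
keeps the later corrections of a tree of approximations within `ε / N_k²`. -/
theorem scaleSeq_succ_lower {ε : ℝ} (h0 : 0 < ε) (h1 : ε < 1 / (2 * Real.pi)) (k : ℕ) :
    1 ≤ scaleSeq ε k ∧ 4 * (scaleSeq ε k : ℝ) ^ 2 / ε ≤ scaleSeq ε (k + 1) := by
  have hε : ε < 1 / 6 := h1.trans (by
    have := Real.pi_gt_three
    rw [div_lt_div_iff₀ (by positivity) (by norm_num)]
    linarith)
  have key : ∀ k, 1 ≤ scaleSeq ε k →
      4 * (scaleSeq ε k : ℝ) ^ 2 / ε ≤ scaleSeq ε (k + 1) := by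
    intro k hk
    have hk' : (1 : ℝ) ≤ scaleSeq ε k := by exact_mod_cast hk
    have h2 : 5 * (scaleSeq ε k : ℝ) ^ 2 / ε < scaleSeq ε (k + 1) + 1 := Nat.lt_floor_add_one _
    have h3 : 1 ≤ (scaleSeq ε k : ℝ) ^ 2 / ε := by
      rw [le_div_iff₀ h0]
      nlinarith
    have h4 : 5 * (scaleSeq ε k : ℝ) ^ 2 / ε =
        4 * (scaleSeq ε k : ℝ) ^ 2 / ε + (scaleSeq ε k : ℝ) ^ 2 / ε := by ring
    linarith
  have pos : ∀ k, 1 ≤ scaleSeq ε k := by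
    intro k
    induction k with
    | zero => exact le_rfl
    | succ k ih =>
      have hk' : (1 : ℝ) ≤ scaleSeq ε k := by exact_mod_cast ih
      have : (1 : ℝ) ≤ scaleSeq ε (k + 1) := by
        refine le_trans ?_ (key k ih)
        rw [le_div_iff₀ h0]
        nlinarith
      exact_mod_cast this
  exact ⟨pos k, key k (pos k)⟩

theorem scaleSeq_pos {ε : ℝ} (h0 : 0 < ε) (h1 : ε < 1 / (2 * Real.pi)) (k : ℕ) :
    (0 : ℝ) < scaleSeq ε k := by
  exact_mod_cast (scaleSeq_succ_lower h0 h1 k).1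

theorem inv_scaleSeq_succ_le {ε : ℝ} (h0 : 0 < ε) (h1 : ε < 1 / (2 * Real.pi)) (k : ℕ) :
    1 / (scaleSeq ε (k + 1) : ℝ) ≤ ε / (4 * (scaleSeq ε k : ℝ) ^ 2) := by
  have hk := scaleSeq_pos h0 h1 k
  have hk' := scaleSeq_pos h0 h1 (k + 1)
  have := (scaleSeq_succ_lower h0 h1 k).2
  rw [div_le_iff₀ h0] at this
  rw [div_le_div_iff₀ hk' (by positivity)]
  linarith

theorem inv_scaleSeq_succ_le_geometric {ε : ℝ} (h0 : 0 < ε) (h1 : ε < 1 / (2 * Real.pi))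
    (k : ℕ) :
    1 / (scaleSeq ε (k + 1) : ℝ) ≤ 1 / (scaleSeq ε k : ℝ) * (1 / 24) := by
  have hε : ε < 1 / 6 := h1.trans (by
    have := Real.pi_gt_three
    rw [div_lt_div_iff₀ (by positivity) (by norm_num)]
    linarith)
  have hk := scaleSeq_pos h0 h1 k
  have hk1 : (1 : ℝ) ≤ scaleSeq ε k := by exact_mod_cast (scaleSeq_succ_lower h0 h1 k).1
  refine (inv_scaleSeq_succ_le h0 h1 k).trans ?_
  rw [div_mul_div_comm, div_le_div_iff₀ (by positivity) (by positivity)]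
  nlinarith [mul_pos hk hk]

theorem inv_scaleSeq_add_le {ε : ℝ} (h0 : 0 < ε) (h1 : ε < 1 / (2 * Real.pi)) (k j : ℕ) :
    1 / (scaleSeq ε (k + j) : ℝ) ≤ 1 / (scaleSeq ε k : ℝ) * (1 / 24) ^ j := by
  induction j with
  | zero => simp
  | succ j ih =>
    have := inv_scaleSeq_succ_le_geometric h0 h1 (k + j)
    rw [← add_assoc, pow_succ]
    linarith

theorem tendsto_inv_scaleSeq {ε : ℝ} (h0 : 0 < ε) (h1 : ε < 1 / (2 * Real.pi)) :
    Tendsto (fun k => 1 / (scaleSeq ε k : ℝ)) atTop (𝓝 0) := by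
  have h := (tendsto_pow_atTop_nhds_zero_of_lt_one (r := (1 / 24 : ℝ)) (by norm_num)
    (by norm_num)).const_mul (1 / (scaleSeq ε 0 : ℝ))
  rw [mul_zero] at h
  refine squeeze_zero (fun k => by positivity) (fun k => ?_) h
  simpa using inv_scaleSeq_add_le h0 h1 0 k

/-- The numerators of the rational approximations `a_k / N_{k+1}` to the point of the Cantor set
coded by `ω`: each is the predecessor rounded down to the next scale, moved up by one grid step
if `ω k` is set. -/
noncomputable def cantorNumerator (ε : ℝ) (ω : ℕ → Bool) : ℕ → ℤ
  | 0 => 1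
  | k + 1 => ⌊(cantorNumerator ε ω k : ℝ) / scaleSeq ε (k + 1) * scaleSeq ε (k + 2)⌋ +
      if ω k then 1 else 0

/-- The rational approximation `a_k / N_{k+1}`. -/
noncomputable def cantorApprox (ε : ℝ) (ω : ℕ → Bool) (k : ℕ) : ℝ :=
  (cantorNumerator ε ω k : ℝ) / scaleSeq ε (k + 1)

theorem cantorApprox_dist {ε : ℝ} (h0 : 0 < ε) (h1 : ε < 1 / (2 * Real.pi)) (ω : ℕ → Bool)
    (k : ℕ) : dist (cantorApprox ε ω k) (cantorApprox ε ω (k + 1)) ≤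
      1 / (scaleSeq ε (k + 2) : ℝ) := by
  have hk := scaleSeq_pos h0 h1 (k + 2)
  set y := cantorApprox ε ω k with hy
  have e : cantorApprox ε ω (k + 1) =
      ((⌊y * scaleSeq ε (k + 2)⌋ + if ω k then 1 else 0 : ℤ) : ℝ) / scaleSeq ε (k + 2) := rfl
  rw [e, Real.dist_eq, sub_div' hk.ne', abs_div, abs_of_pos hk]
  refine div_le_div_of_nonneg_right ?_ hk.le
  have a := Int.floor_le (y * scaleSeq ε (k + 2))
  have b := Int.lt_floor_add_one (y * scaleSeq ε (k + 2))
  rw [abs_le]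
  split_ifs <;> push_cast <;> constructor <;> linarith

theorem exists_tendsto_cantorApprox {ε : ℝ} (h0 : 0 < ε) (h1 : ε < 1 / (2 * Real.pi))
    (ω : ℕ → Bool) : ∃ v, Tendsto (cantorApprox ε ω) atTop (𝓝 v) := by
  refine cauchySeq_tendsto_of_complete (cauchySeq_of_le_geometric (1 / 24)
    (1 / (scaleSeq ε 2 : ℝ)) (by norm_num) fun k => (cantorApprox_dist h0 h1 ω k).trans ?_)
  have := inv_scaleSeq_add_le h0 h1 2 k
  rwa [add_comm 2 k] at this

/-- The limit of the rational approximations; it exists when `0 < ε < 1 / (2π)`, and has no meaning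
otherwise. -/
noncomputable def cantorPoint (ε : ℝ) (ω : ℕ → Bool) : ℝ :=
  limUnder atTop (cantorApprox ε ω)

/-- The corrections after step `k` sum to at most `1 / N_{k+2}` times `∑ 24⁻ʲ = 24 / 23`. -/
theorem cantorPoint_dist {ε : ℝ} (h0 : 0 < ε) (h1 : ε < 1 / (2 * Real.pi)) (ω : ℕ → Bool)
    (k : ℕ) : |cantorApprox ε ω k - cantorPoint ε ω| ≤ 24 / 23 / (scaleSeq ε (k + 2) : ℝ) := by
  have ht : Tendsto (cantorApprox ε ω) atTop (𝓝 (cantorPoint ε ω)) :=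
    tendsto_nhds_limUnder (exists_tendsto_cantorApprox h0 h1 ω)
  have := dist_le_of_le_geometric_of_tendsto₀ (1 / 24) (1 / (scaleSeq ε (k + 2) : ℝ))
    (f := fun j => cantorApprox ε ω (j + k)) (by norm_num) (fun j => ?_)
    ((tendsto_add_atTop_iff_nat k).2 ht)
  · rw [zero_add, Real.dist_eq] at this
    refine this.trans (le_of_eq ?_)
    field_simp
    norm_num
  · have e : j + 1 + k = j + k + 1 := by ring
    simp only [e]
    refine (cantorApprox_dist h0 h1 ω (j + k)).trans ?_
    have := inv_scaleSeq_add_le h0 h1 (k + 2) j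
    rwa [show k + 2 + j = j + k + 2 by ring] at this

/-- All points lie in a half-circle, so that their negatives are distinct from them on `ℝ/ℤ`. -/
theorem cantorPoint_mem_Ioo {ε : ℝ} (h0 : 0 < ε) (h1 : ε < 1 / (2 * Real.pi)) (ω : ℕ → Bool) :
    cantorPoint ε ω ∈ Set.Ioo (0 : ℝ) (1 / 2) := by
  have h := abs_le.1 (cantorPoint_dist h0 h1 ω 0)
  have e : cantorApprox ε ω 0 = 1 / (scaleSeq ε 1 : ℝ) := by simp [cantorApprox, cantorNumerator]
  have a := inv_scaleSeq_succ_le_geometric h0 h1 0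
  have b := inv_scaleSeq_succ_le_geometric h0 h1 1
  have c := scaleSeq_pos h0 h1 1
  have d : 0 < 1 / (scaleSeq ε 1 : ℝ) := by positivity
  have e2 : 24 / 23 / (scaleSeq ε 2 : ℝ) = 24 / 23 * (1 / (scaleSeq ε 2 : ℝ)) := by ring
  have f : (scaleSeq ε 0 : ℝ) = 1 := by simp [scaleSeq]
  simp only [zero_add] at h a b
  rw [e, e2] at h
  rw [f] at a
  rw [show 1 + 1 = 2 from rfl] at b
  constructor <;> linarith

theorem continuous_cantorNumerator (ε : ℝ) (k : ℕ) :
    Continuous fun ω => cantorNumerator ε ω k := by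
  induction k with
  | zero => exact continuous_const
  | succ k ih =>
    have h : Continuous fun p : ℤ × Bool =>
        ⌊(p.1 : ℝ) / scaleSeq ε (k + 1) * scaleSeq ε (k + 2)⌋ + if p.2 then 1 else 0 :=
      continuous_of_discreteTopology
    exact h.comp (ih.prodMk (continuous_apply k))

theorem continuous_cantorPoint {ε : ℝ} (h0 : 0 < ε) (h1 : ε < 1 / (2 * Real.pi)) :
    Continuous (cantorPoint ε) := by
  have hu : TendstoUniformly (fun k ω => cantorApprox ε ω k) (cantorPoint ε) atTop := by
    rw [Metric.tendstoUniformly_iff]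
    intro δ hδ
    have h := ((tendsto_inv_scaleSeq h0 h1).const_mul (24 / 23)).comp (tendsto_add_atTop_nat 2)
    rw [mul_zero] at h
    filter_upwards [h.eventually (gt_mem_nhds hδ)] with k hk ω
    rw [dist_comm, Real.dist_eq]
    refine (cantorPoint_dist h0 h1 ω k).trans_lt (lt_of_eq_of_lt ?_ hk)
    simp [div_eq_mul_inv]
  refine hu.continuous (Frequently.of_forall fun k => ?_)
  exact (continuous_of_discreteTopology.comp (continuous_cantorNumerator ε k)).div_const _

theorem cantorNumerator_congr (ε : ℝ) {ω ω' : ℕ → Bool} (k : ℕ) (h : ∀ j < k, ω j = ω' j) :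
    cantorNumerator ε ω k = cantorNumerator ε ω' k := by
  induction k with
  | zero => rfl
  | succ k ih =>
    rw [cantorNumerator, cantorNumerator, ih fun j hj => h j (hj.trans k.lt_succ_self),
      h k k.lt_succ_self]

/-- Two codes that first differ at `k` give approximations one grid step `1 / N_{k+2}` apart, and
the later corrections are too small to close that gap. -/
theorem cantorPoint_injective {ε : ℝ} (h0 : 0 < ε) (h1 : ε < 1 / (2 * Real.pi)) :
    Function.Injective (cantorPoint ε) := by
  intro ω ω' h
  by_contra hne
  have hex : ∃ k, ω k ≠ ω' k := Function.ne_iff.1 hne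
  classical
  set k := Nat.find hex
  have hk : ω k ≠ ω' k := Nat.find_spec hex
  have hc := cantorNumerator_congr ε k fun j hj => not_not.1 (Nat.find_min hex hj)
  have hN := scaleSeq_pos h0 h1 (k + 2)
  have d : 0 < 1 / (scaleSeq ε (k + 2) : ℝ) := by positivity
  have hgap : 1 / (scaleSeq ε (k + 2) : ℝ) ≤
      |cantorApprox ε ω (k + 1) - cantorApprox ε ω' (k + 1)| := by
    rw [cantorApprox, cantorApprox, cantorNumerator, cantorNumerator, hc, ← sub_div, abs_div,
      abs_of_pos hN]
    refine div_le_div_of_nonneg_right ?_ hN.le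
    rcases hb : ω k <;> rcases hb' : ω' k <;> simp_all
  have a := cantorPoint_dist h0 h1 ω (k + 1)
  have b := cantorPoint_dist h0 h1 ω' (k + 1)
  have c := inv_scaleSeq_succ_le_geometric h0 h1 (k + 2)
  have e2 : 24 / 23 / (scaleSeq ε (k + 2 + 1) : ℝ) =
      24 / 23 * (1 / (scaleSeq ε (k + 2 + 1) : ℝ)) := by
    ring
  rw [show k + 1 + 2 = k + 2 + 1 by ring, e2] at a b
  rw [← h] at b
  have t := abs_sub_le (cantorApprox ε ω (k + 1)) (cantorPoint ε ω) (cantorApprox ε ω' (k + 1))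
  rw [abs_sub_comm (cantorPoint ε ω)] at t
  linarith

theorem norm_coe_le_abs_sub_intCast (x : ℝ) (m : ℤ) : ‖(x : UnitAddCircle)‖ ≤ |x - m| := by
  rw [UnitAddCircle.norm_eq]
  exact round_le x m

theorem coe_cantorPoint_mem_gammaSet {ε : ℝ} (h0 : 0 < ε) (h1 : ε < 1 / (2 * Real.pi))
    (ω : ℕ → Bool) : (cantorPoint ε ω : UnitAddCircle) ∈ gammaSet ε := by
  intro k hk
  obtain ⟨k, rfl⟩ := Nat.exists_eq_add_of_le' hk
  have hN := scaleSeq_pos h0 h1 (k + 1)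
  have a := cantorPoint_dist h0 h1 ω k
  have b := inv_scaleSeq_succ_le h0 h1 (k + 1)
  rw [← AddCircle.coe_nsmul, nsmul_eq_mul]
  refine (norm_coe_le_abs_sub_intCast _ (cantorNumerator ε ω k)).trans ?_
  have e : (scaleSeq ε (k + 1) : ℝ) * cantorPoint ε ω - cantorNumerator ε ω k =
      scaleSeq ε (k + 1) * (cantorPoint ε ω - cantorApprox ε ω k) := by
    rw [cantorApprox]
    field_simp
  rw [e, abs_mul, abs_of_pos hN, abs_sub_comm]
  have e2 : 24 / 23 / (scaleSeq ε (k + 2) : ℝ) = 24 / 23 * (1 / (scaleSeq ε (k + 1 + 1) : ℝ)) := by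
    ring
  rw [e2] at a
  calc (scaleSeq ε (k + 1) : ℝ) * |cantorApprox ε ω k - cantorPoint ε ω|
      ≤ scaleSeq ε (k + 1) * (4 * (ε / (4 * (scaleSeq ε (k + 1) : ℝ) ^ 2))) := by
        have : 0 ≤ ε / (4 * (scaleSeq ε (k + 1) : ℝ) ^ 2) := by positivity
        gcongr
        linarith
    _ = ε / scaleSeq ε (k + 1) := by field_simp

theorem neg_mem_gammaSet {ε : ℝ} {u : UnitAddCircle} (h : u ∈ gammaSet ε) : -u ∈ gammaSet ε := by
  intro k hk
  rw [smul_neg, norm_neg]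
  exact h k hk

/-- Flipping a far bit of a sequence moves it by an arbitrarily small amount. -/
theorem perfectSpace_cantor : PerfectSpace (ℕ → Bool) := by
  refine perfectSpace_iff_forall_not_isolated.2 fun x => ?_
  have ht : Tendsto (fun n => Function.update x n (!x n)) atTop (𝓝[≠] x) := by
    refine tendsto_nhdsWithin_iff.2
      ⟨tendsto_pi_nhds.2 fun i => ?_, Eventually.of_forall fun n => ?_⟩
    · refine tendsto_const_nhds.congr' ?_
      filter_upwards [eventually_gt_atTop i] with n hn
      rw [Function.update_of_ne hn.ne]
    · intro h
      have := congrFun h n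
      simp at this
  exact ht.neBot

theorem isCantorLike_range {Y : Type*} [TopologicalSpace Y] [T2Space Y] {w : (ℕ → Bool) → Y}
    (hw : Continuous w) (hi : Function.Injective w) : IsCantorLike (Set.range w) := by
  have hemb := hw.isClosedEmbedding hi
  refine ⟨Set.range_nonempty w, isCompact_range hw, ⟨hemb.isClosed_range, ?_⟩,
    hemb.isEmbedding.isTotallyDisconnected_range.2 inferInstance⟩
  rw [preperfect_iff_nhds]
  rintro _ ⟨x, rfl⟩ U hU
  have := perfectSpace_cantor
  have hx := (PerfectSpace.univ_preperfect (α := ℕ → Bool))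
  rw [preperfect_iff_nhds] at hx
  obtain ⟨y, hy, hne⟩ := hx x trivial _ (hw.continuousAt hU)
  exact ⟨w y, ⟨hy.1, y, rfl⟩, fun h => hne (hi h)⟩

/-- The point of the symmetric Cantor set coded by `ω`: the first bit is the sign. -/
noncomputable def signedCantorPoint (ε : ℝ) (ω : ℕ → Bool) : UnitAddCircle :=
  if ω 0 then (cantorPoint ε (fun k => ω (k + 1)) : UnitAddCircle)
  else -(cantorPoint ε (fun k => ω (k + 1)) : UnitAddCircle)

theorem continuous_signedCantorPoint {ε : ℝ} (h0 : 0 < ε) (h1 : ε < 1 / (2 * Real.pi)) :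
    Continuous (signedCantorPoint ε) := by
  have hc : Continuous fun ω : ℕ → Bool =>
      (cantorPoint ε (fun k => ω (k + 1)) : UnitAddCircle) :=
    (AddCircle.continuous_mk' 1).comp ((continuous_cantorPoint h0 h1).comp
      (continuous_pi fun k => continuous_apply (k + 1)))
  refine continuous_if (fun ω hω => ?_) hc.continuousOn hc.neg.continuousOn
  have : IsClopen {ω : ℕ → Bool | ω 0 = true} :=
    (isClopen_discrete {true}).preimage (continuous_apply 0)
  rw [this.frontier_eq] at hω
  exact hω.elim

theorem signedCantorPoint_injective {ε : ℝ} (h0 : 0 < ε) (h1 : ε < 1 / (2 * Real.pi)) :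
    Function.Injective (signedCantorPoint ε) := by
  intro ω ω' h
  have key : ω 0 = ω' 0 ∧ cantorPoint ε (fun k => ω (k + 1)) =
      cantorPoint ε (fun k => ω' (k + 1)) := by
    have a := cantorPoint_mem_Ioo h0 h1 fun k => ω (k + 1)
    have b := cantorPoint_mem_Ioo h0 h1 fun k => ω' (k + 1)
    simp only [signedCantorPoint, ← AddCircle.coe_neg] at h
    have inj : ∀ x y : ℝ, x ∈ Set.Ico (-(1 / 2) : ℝ) (-(1 / 2) + 1) →
        y ∈ Set.Ico (-(1 / 2) : ℝ) (-(1 / 2) + 1) → (x : UnitAddCircle) = y → x = y :=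
      fun x y hx hy => (AddCircle.coe_eq_coe_iff_of_mem_Ico hx hy).1
    obtain ⟨a1, a2⟩ := a
    obtain ⟨b1, b2⟩ := b
    rcases hb : ω 0 <;> rcases hb' : ω' 0 <;> simp only [hb, hb'] at h <;>
      have := inj _ _ ⟨by norm_num; linarith, by norm_num; linarith⟩
        ⟨by norm_num; linarith, by norm_num; linarith⟩ h <;>
      first | (exfalso; linarith) | exact ⟨rfl, by linarith⟩
  have tail := cantorPoint_injective h0 h1 key.2
  funext k
  cases k with
  | zero => exact key.1
  | succ k => exact congrFun tail k

/-- Transport of a Gaussian law along a Borel isomorphism of `ℝ` with the Cantor space. -/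
theorem exists_nonatomic_measure_cantor :
    ∃ P : Measure (ℕ → Bool), IsProbabilityMeasure P ∧ NullSingletonClass P := by
  have hb : ¬ Countable (ℕ → Bool) := by
    intro h
    have h1 := Cardinal.mk_le_aleph0 (α := ℕ → Bool)
    rw [← Cardinal.power_def] at h1
    simp only [Cardinal.mk_bool, Cardinal.mk_nat] at h1
    exact (Cardinal.cantor Cardinal.aleph0).not_ge h1
  have hr : ¬ Countable ℝ := not_countable
  let e := PolishSpace.measurableEquivOfNotCountable hr hb
  have := ProbabilityTheory.nullSingletonClass_gaussianReal (μ := 0) (v := 1) one_ne_zero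
  refine ⟨(ProbabilityTheory.gaussianReal 0 1).map e,
    Measure.isProbabilityMeasure_map e.measurable.aemeasurable, ⟨fun x => ?_⟩⟩
  rw [e.map_apply]
  exact (Set.subsingleton_singleton.preimage e.injective).measure_zero _

/-- The spectral measure of a real function is symmetric, so the measure on the Cantor set is
averaged with its reflection; the Cantor set is invariant under `u ↦ -u`. -/
theorem exists_symmetric_measure_on_cantorLike {ε : ℝ} (h0 : 0 < ε)
    (h1 : ε < 1 / (2 * Real.pi)) :
    ∃ (K : Set UnitAddCircle) (ν : Measure UnitAddCircle),
      IsCantorLike K ∧ K ⊆ gammaSet ε ∧ IsProbabilityMeasure ν ∧ NullSingletonClass ν ∧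
      ν Kᶜ = 0 ∧ ν.map (fun u => -u) = ν := by
  obtain ⟨P, hP, hPn⟩ := exists_nonatomic_measure_cantor
  have hc := continuous_signedCantorPoint h0 h1
  have hi := signedCantorPoint_injective h0 h1
  have hK := isCantorLike_range hc hi
  have hneg : ∀ ω, -signedCantorPoint ε ω ∈ Set.range (signedCantorPoint ε) := by
    intro ω
    refine ⟨fun k => Nat.casesOn k (!ω 0) fun k => ω (k + 1), ?_⟩
    rcases hb : ω 0 <;> simp [signedCantorPoint, hb]
  set w := signedCantorPoint ε
  have hm : Measurable w := hc.measurable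
  have hτ : IsProbabilityMeasure (P.map w) := Measure.isProbabilityMeasure_map hm.aemeasurable
  set τ := P.map w with hτd
  have hneg' : Measurable fun u : UnitAddCircle => -u := measurable_neg
  have hτ' : IsProbabilityMeasure (τ.map fun u => -u) :=
    Measure.isProbabilityMeasure_map hneg'.aemeasurable
  have atom : ∀ x, τ {x} = 0 := fun x => by
    rw [hτd, Measure.map_apply hm (measurableSet_singleton x)]
    exact (Set.subsingleton_singleton.preimage hi).measure_zero _
  have hKm : MeasurableSet (Set.range w)ᶜ := (isCompact_range hc).measurableSet.compl
  refine ⟨Set.range w, (2⁻¹ : ENNReal) • (τ + τ.map fun u => -u), hK, ?_, ⟨?_⟩, ⟨fun x => ?_⟩,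
    ?_, ?_⟩
  · rintro _ ⟨ω, rfl⟩
    simp only [w, signedCantorPoint]
    split_ifs
    · exact coe_cantorPoint_mem_gammaSet h0 h1 _
    · exact neg_mem_gammaSet (coe_cantorPoint_mem_gammaSet h0 h1 _)
  · simp only [Measure.smul_apply, Measure.add_apply, measure_univ, smul_eq_mul]
    rw [one_add_one_eq_two]
    exact ENNReal.inv_mul_cancel two_ne_zero ENNReal.ofNat_ne_top
  · have : (fun u : UnitAddCircle => -u) ⁻¹' {x} = {-x} := by
      ext u
      simp
    simp [atom, Measure.map_apply hneg' (measurableSet_singleton x), this]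
  · have e1 : w ⁻¹' (Set.range w)ᶜ = ∅ := by
      ext ω
      simp
    have e2 : w ⁻¹' ((fun u => -u) ⁻¹' (Set.range w)ᶜ) = ∅ := by
      ext ω
      simpa using hneg ω
    simp only [Measure.smul_apply, Measure.add_apply, Measure.map_apply hneg' hKm]
    rw [hτd, Measure.map_apply hm hKm, Measure.map_apply hm (hneg' hKm), e1, e2]
    simp
  · rw [Measure.map_smul, Measure.map_add _ _ hneg', Measure.map_map hneg' hneg', add_comm]
    congr 2
    convert Measure.map_id
    ext u
    simp

/-! ### Gaussian processes with prescribed covariance -/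

theorem lipschitzWith_exp_I_mul : LipschitzWith 1 fun x : ℝ => Complex.exp (x * Complex.I) := by
  refine LipschitzWith.of_dist_le_mul fun x y => ?_
  rw [dist_eq_norm, NNReal.coe_one, one_mul, Real.dist_eq]
  have e : Complex.exp (x * Complex.I) - Complex.exp (y * Complex.I) =
      Complex.exp (y * Complex.I) * (Complex.exp (Complex.I * ((x - y : ℝ) : ℂ)) - 1) := by
    rw [mul_sub, ← Complex.exp_add, mul_one]
    congr 2
    push_cast
    ring
  rw [e, norm_mul, Complex.norm_exp_ofReal_mul_I, one_mul]
  exact Real.norm_exp_I_mul_ofReal_sub_one_le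

theorem integrable_exp_I_mul {Ω : Type*} [MeasurableSpace Ω] {P : Measure Ω} [IsFiniteMeasure P]
    {f : Ω → ℝ} (hf : AEMeasurable f P) :
    Integrable (fun ω => Complex.exp (f ω * Complex.I)) P := by
  refine Integrable.of_bound (C := 1) ?_ (Eventually.of_forall fun ω => ?_)
  · exact (lipschitzWith_exp_I_mul.continuous.measurable.comp_aemeasurable hf).aestronglyMeasurable
  · rw [Complex.norm_exp_ofReal_mul_I]

/-- Characteristic functions depend continuously on a random variable in the `L²` norm. -/
theorem continuous_integral_exp_Lp {Ω : Type*} [MeasurableSpace Ω] {P : Measure Ω}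
    [IsProbabilityMeasure P] :
    Continuous fun f : Lp ℝ 2 P => ∫ ω, Complex.exp (f ω * Complex.I) ∂P := by
  refine (LipschitzWith.of_dist_le_mul (K := 1) fun f g => ?_).continuous
  have hfm := (Lp.stronglyMeasurable f).measurable.aemeasurable (μ := P)
  have hgm := (Lp.stronglyMeasurable g).measurable.aemeasurable (μ := P)
  have hi : Integrable (fun ω => f ω - g ω) P :=
    ((Lp.memLp f).sub (Lp.memLp g)).integrable one_le_two
  rw [dist_eq_norm, ← integral_sub (integrable_exp_I_mul hfm) (integrable_exp_I_mul hgm),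
    NNReal.coe_one, one_mul, dist_eq_norm]
  calc ‖∫ ω, (Complex.exp (f ω * Complex.I) - Complex.exp (g ω * Complex.I)) ∂P‖
      ≤ ∫ ω, ‖f ω - g ω‖ ∂P := by
        refine norm_integral_le_of_norm_le hi.norm (Eventually.of_forall fun ω => ?_)
        have := lipschitzWith_exp_I_mul.dist_le_mul (f ω) (g ω)
        rwa [dist_eq_norm, dist_eq_norm, NNReal.coe_one, one_mul] at this
    _ = (eLpNorm (fun ω => f ω - g ω) 1 P).toReal := by
        rw [eLpNorm_one_eq_lintegral_enorm, integral_norm_eq_lintegral_enorm hi.1]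
    _ ≤ (eLpNorm (fun ω => f ω - g ω) 2 P).toReal := by
        refine ENNReal.toReal_mono ((Lp.memLp f).sub (Lp.memLp g)).2.ne ?_
        exact eLpNorm_le_eLpNorm_of_exponent_le one_le_two hi.1
    _ = ‖f - g‖ := by
        rw [Lp.norm_def]
        congr 1
        exact eLpNorm_congr_ae (Lp.coeFn_sub f g).symm

/-- A linear combination in `L²` is almost everywhere the pointwise linear combination of
representatives. -/
theorem coeFn_linearCombination {Ω ι E : Type*} [MeasurableSpace Ω] {P : Measure Ω}
    [NormedAddCommGroup E] [NormedSpace ℝ E] (g : ι → Lp E 2 P) (a : ι →₀ ℝ) :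
    (Finsupp.linearCombination ℝ g a : Ω → E) =ᵐ[P]
      fun ω => Finsupp.linearCombination ℝ (fun i => g i ω) a := by
  induction a using Finsupp.induction_linear with
  | zero =>
    rw [map_zero]
    filter_upwards [Lp.coeFn_zero E 2 P] with ω h
    rw [h, map_zero, Pi.zero_apply]
  | add a b ha hb =>
    rw [map_add]
    filter_upwards [ha, hb, Lp.coeFn_add (Finsupp.linearCombination ℝ g a)
      (Finsupp.linearCombination ℝ g b)] with ω h1 h2 h3
    rw [h3, Pi.add_apply, h1, h2, map_add]
  | single i c =>
    rw [Finsupp.linearCombination_single]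
    filter_upwards [Lp.coeFn_smul c (g i)] with ω h
    rw [h, Pi.smul_apply, Finsupp.linearCombination_single]

theorem exists_linearIsometry_of_orthonormal {ι H E : Type*} [NormedAddCommGroup H]
    [InnerProductSpace ℝ H] [NormedAddCommGroup E] [InnerProductSpace ℝ E] [CompleteSpace E]
    (b : HilbertBasis ι ℝ H) {g : ι → E} (hg : Orthonormal ℝ g) :
    ∃ W : H →ₗᵢ[ℝ] E, ∀ i, W (b i) = g i := by
  classical
  have hV : OrthogonalFamily ℝ (fun _ : ι => ℝ)
    fun i => LinearIsometry.toSpanSingleton ℝ E (hg.norm_eq_one i) := hg.orthogonalFamily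
  refine ⟨hV.linearIsometry.comp b.repr.toLinearIsometry, fun i => ?_⟩
  change hV.linearIsometry (b.repr (b i)) = g i
  rw [b.repr_self]
  refine (hV.linearIsometry_apply_single (i := i) (1 : ℝ)).trans ?_
  simp

/-- An isonormal Gaussian process over `H`: expanding along a Hilbert basis of `H` with independent
standard normal coefficients embeds `H` isometrically into an `L²` space of centred Gaussian
variables. The Gaussian law is computed on finite combinations of the basis and extends by
density. -/
theorem exists_isonormal.{u} (H : Type u) [NormedAddCommGroup H] [InnerProductSpace ℝ H]
    [CompleteSpace H] :
    ∃ (Ω : Type u) (_ : MeasurableSpace Ω) (P : Measure Ω) (_ : IsProbabilityMeasure P)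
      (W : H →ₗᵢ[ℝ] Lp ℝ 2 P), ∀ h : H,
        ∫ ω, Complex.exp (W h ω * Complex.I) ∂P = Complex.exp (-(‖h‖ ^ 2 / 2 : ℝ)) := by
  obtain ⟨w, b, hb⟩ := exists_hilbertBasis ℝ H
  let P : Measure (w → ℝ) := Measure.infinitePi fun _ => ProbabilityTheory.gaussianReal 0 1
  have hmp : ∀ i : w, MeasurePreserving (fun ω : w → ℝ => ω i) P
      (ProbabilityTheory.gaussianReal 0 1) := fun i =>
    measurePreserving_eval_infinitePi (fun _ : w => ProbabilityTheory.gaussianReal 0 1) i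
  have hL : ∀ i : w, MemLp (fun ω : w → ℝ => ω i) 2 P := fun i =>
    (ProbabilityTheory.memLp_id_gaussianReal 2).comp_measurePreserving (hmp i)
  let g : w → Lp ℝ 2 P := fun i => (hL i).toLp
  have hinner : ∀ i j, inner ℝ (g i) (g j) = ∫ ω, ω i * ω j ∂P := by
    intro i j
    rw [L2.inner_def]
    refine integral_congr_ae ?_
    filter_upwards [(hL i).coeFn_toLp, (hL j).coeFn_toLp] with ω h1 h2
    simp only [g]
    rw [h1, h2]
    simp [mul_comm]
  have hind : ProbabilityTheory.iIndepFun (fun i (ω : w → ℝ) => ω i) P :=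
    ProbabilityTheory.iIndepFun_infinitePi (X := fun (_ : w) (x : ℝ) => x) fun _ => measurable_id
  have hmean : ∀ i : w, ∫ ω, ω i ∂P = 0 := by
    intro i
    have h := integral_map (μ := P) (hmp i).measurable.aemeasurable
      (f := fun x : ℝ => x) aestronglyMeasurable_id
    rw [← h, (hmp i).map_eq, ProbabilityTheory.integral_id_gaussianReal]
  have hsq : ∀ i : w, ∫ ω, ω i * ω i ∂P = 1 := by
    intro i
    have h := integral_map (μ := P) (hmp i).measurable.aemeasurable
      (f := fun x : ℝ => x * x) (by fun_prop)
    have hv := ProbabilityTheory.variance_id_gaussianReal (μ := 0) (v := 1)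
    rw [ProbabilityTheory.variance_eq_integral aemeasurable_id] at hv
    simp only [id, ProbabilityTheory.integral_id_gaussianReal, sub_zero, sq] at hv
    rw [← h, (hmp i).map_eq, hv, NNReal.coe_one]
  classical
  have hon : Orthonormal ℝ g := by
    rw [orthonormal_iff_ite]
    intro i j
    rw [hinner]
    split_ifs with hij
    · subst hij
      exact hsq i
    · have := (hind.indepFun hij).integral_mul_eq_mul_integral (hL i).1 (hL j).1
      simp only [Pi.mul_apply, hmean, mul_zero] at this
      exact this
  obtain ⟨W, hW⟩ := exists_linearIsometry_of_orthonormal b hon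
  refine ⟨w → ℝ, inferInstance, P, inferInstance, W, fun h => ?_⟩
  have hclosed : IsClosed {h : H | ∫ ω, Complex.exp (W h ω * Complex.I) ∂P =
      Complex.exp (-(‖h‖ ^ 2 / 2 : ℝ))} := by
    refine isClosed_eq (continuous_integral_exp_Lp.comp W.continuous) ?_
    fun_prop
  have hspan : (Submodule.span ℝ (Set.range b) : Set H) ⊆ {h : H |
      ∫ ω, Complex.exp (W h ω * Complex.I) ∂P = Complex.exp (-(‖h‖ ^ 2 / 2 : ℝ))} := by
    intro h hh
    obtain ⟨a, rfl⟩ := (Finsupp.mem_span_range_iff_exists_finsupp).1 hh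
    change ∫ ω, Complex.exp (W (Finsupp.linearCombination ℝ b a) ω * Complex.I) ∂P =
      Complex.exp (-(‖Finsupp.linearCombination ℝ b a‖ ^ 2 / 2 : ℝ))
    have e1 : W (Finsupp.linearCombination ℝ b a) = Finsupp.linearCombination ℝ g a := by
      have := Finsupp.apply_linearCombination ℝ W.toLinearMap b a
      have e : (W.toLinearMap ∘ b) = g := funext hW
      rw [e] at this
      exact this
    have e2 : ‖Finsupp.linearCombination ℝ b a‖ ^ 2 = ∑ i ∈ a.support, a i ^ 2 := by
      rw [← real_inner_self_eq_norm_sq, b.orthonormal.inner_finsupp_eq_sum_left]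
      simp [Finsupp.sum, sq]
    have e3 : (fun ω => Complex.exp (Finsupp.linearCombination ℝ g a ω * Complex.I)) =ᵐ[P]
        fun ω => ∏ i : a.support,
          Complex.exp ((a i : ℂ) * (a.support.restrict ω i : ℂ) * Complex.I) := by
      filter_upwards [coeFn_linearCombination g a,
        (ae_ball_iff a.support.countable_toSet).2 fun i _ => (hL i).coeFn_toLp] with ω h1 h2
      rw [h1, Finsupp.linearCombination_apply, Finsupp.sum, ← Complex.exp_sum]
      congr 1
      rw [Complex.ofReal_sum, Finset.sum_mul, ← Finset.sum_coe_sort]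
      refine Finset.sum_congr rfl fun i _ => ?_
      rw [h2 i i.2]
      simp
    rw [e1, e2, integral_congr_ae e3]
    rw [integral_restrict_infinitePi (fun _ : w => ProbabilityTheory.gaussianReal 0 1)
      (f := fun y => ∏ i : a.support, Complex.exp ((a i : ℂ) * (y i : ℂ) * Complex.I))
      (Measurable.aestronglyMeasurable (by fun_prop)),
      integral_fintype_prod_eq_prod
        (f := fun (i : a.support) (y : ℝ) => Complex.exp ((a i : ℂ) * (y : ℂ) * Complex.I))]
    simp_rw [← charFun_apply_real, ProbabilityTheory.charFun_gaussianReal]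
    rw [← Complex.exp_sum]
    congr 1
    rw [Finset.sum_coe_sort a.support (fun i => ((a i : ℝ) : ℂ) * ((0 : ℝ) : ℂ) * Complex.I -
      ((1 : NNReal) : ℝ) * (a i : ℂ) ^ 2 / 2)]
    push_cast
    simp [Finset.sum_div, Finset.sum_neg_distrib]
  have := hclosed.closure_subset_iff.2 hspan
  rw [← Submodule.topologicalClosure_coe, b.dense_span] at this
  exact this trivial

theorem measurable_linearCombination {ι : Type*} (a : ι →₀ ℝ) :
    Measurable fun x : ι → ℝ => Finsupp.linearCombination ℝ x a := by
  simp only [Finsupp.linearCombination_apply, Finsupp.sum]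
  fun_prop

/-- `μ` is the centred Gaussian measure on `ι → ℝ` with covariance `⟪v i, v j⟫`: the law of every
finite linear combination of coordinates is the normal law with the corresponding variance. -/
def IsGaussianWithCovariance {ι H : Type*} [NormedAddCommGroup H] [InnerProductSpace ℝ H]
    (μ : Measure (ι → ℝ)) (v : ι → H) : Prop :=
  ∀ a : ι →₀ ℝ, μ.map (fun x => Finsupp.linearCombination ℝ x a) =
    ProbabilityTheory.gaussianReal 0 (‖Finsupp.linearCombination ℝ v a‖₊ ^ 2)

/-- Every family of vectors of a real Hilbert space is realised as the covariance structure of a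
centred Gaussian measure: the joint law of its images in an isonormal process. -/
theorem exists_gaussian_measure {ι H : Type*} [NormedAddCommGroup H] [InnerProductSpace ℝ H]
    [CompleteSpace H] (v : ι → H) :
    ∃ μ : Measure (ι → ℝ), IsProbabilityMeasure μ ∧ IsGaussianWithCovariance μ v := by
  obtain ⟨Ω, _, P, _, W, hW⟩ := exists_isonormal H
  have hm : Measurable fun (ω : Ω) i => W (v i) ω :=
    measurable_pi_lambda _ fun i => (Lp.stronglyMeasurable (W (v i))).measurable
  refine ⟨P.map fun ω i => W (v i) ω, Measure.isProbabilityMeasure_map hm.aemeasurable,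
    fun a => ?_⟩
  rw [Measure.map_map (measurable_linearCombination a) hm]
  have hmc := (measurable_linearCombination a).comp hm
  have := Measure.isProbabilityMeasure_map (μ := P) hmc.aemeasurable
  refine Measure.ext_of_charFun ?_
  ext t
  rw [charFun_apply_real, integral_map hmc.aemeasurable (by fun_prop),
    ProbabilityTheory.charFun_gaussianReal]
  have e1 : W (t • Finsupp.linearCombination ℝ v a) =
      Finsupp.linearCombination ℝ (fun i => W (v i)) (t • a) := by
    rw [← map_smul]
    exact Finsupp.apply_linearCombination ℝ W.toLinearMap v (t • a)
  have h := hW (t • Finsupp.linearCombination ℝ v a)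
  rw [e1] at h
  have e2 := coeFn_linearCombination (fun i => W (v i)) (t • a)
  refine Eq.trans (integral_congr_ae ?_) (h.trans ?_)
  · filter_upwards [e2] with ω hω
    rw [hω, map_smul]
    simp
  · rw [norm_smul, mul_pow]
    congr 1
    simp
    ring

/-! ### An ergodicity criterion -/

/-- Square-integrable functions whose integrals determine finite measures span a dense subspace of
`L²`: an `h` orthogonal to all of them satisfies `h⁺ m = h⁻ m`. -/
theorem topologicalClosure_span_eq_top_of_separating {Y C : Type*} [MeasurableSpace Y]
    {m : Measure Y} [IsProbabilityMeasure m] {ψ : C → Y → ℝ} (hψ : ∀ c, MemLp (ψ c) 2 m)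
    (hsep : ∀ μ₁ μ₂ : Measure Y, IsFiniteMeasure μ₁ → IsFiniteMeasure μ₂ →
      (∀ c, ∫ y, ψ c y ∂μ₁ = ∫ y, ψ c y ∂μ₂) → μ₁ = μ₂) :
    (Submodule.span ℝ (Set.range fun c => (hψ c).toLp)).topologicalClosure = ⊤ := by
  rw [Submodule.topologicalClosure_eq_top_iff, Submodule.eq_bot_iff]
  intro h hh
  have hperp : ∀ c, ∫ y, ψ c y * h y ∂m = 0 := by
    intro c
    have h1 := (Submodule.mem_orthogonal _ _).1 hh _ (Submodule.subset_span ⟨c, rfl⟩)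
    rw [L2.inner_def] at h1
    rw [← h1]
    refine integral_congr_ae ?_
    filter_upwards [(hψ c).coeFn_toLp] with y hy
    rw [hy]
    simp [mul_comm]
  have hm : Measurable h := (Lp.stronglyMeasurable h).measurable
  have hint : Integrable h m := (Lp.memLp h).integrable one_le_two
  have hI : ∀ c, Integrable (fun y => ψ c y * h y) m := fun c =>
    (hψ c).integrable_mul (Lp.memLp h)
  have hfin : ∀ f : Y → ℝ, Integrable f m →
      IsFiniteMeasure (m.withDensity fun y => ENNReal.ofReal (f y)) := fun f hf =>
    isFiniteMeasure_withDensity_ofReal hf.2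
  -- The positive and negative parts of `h` give two finite measures that `ψ` cannot tell apart.
  have heq := hsep _ _ (hfin _ hint) (hfin _ hint.neg) fun c => by
    rw [integral_withDensity_eq_integral_toReal_smul hm.ennreal_ofReal (by simp),
      integral_withDensity_eq_integral_toReal_smul hm.neg.ennreal_ofReal (by simp), ← sub_eq_zero,
      ← integral_sub, ← hperp c]
    · refine integral_congr_ae (Eventually.of_forall fun y => ?_)
      simp only [ENNReal.toReal_ofReal', smul_eq_mul, Pi.neg_apply]
      rw [← sub_mul, max_zero_sub_eq_self, mul_comm]
    · refine (hI c).abs.mono' ?_ (Eventually.of_forall fun y => ?_)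
      · exact (hm.ennreal_ofReal.ennreal_toReal.aestronglyMeasurable).smul (hψ c).1
      · simp only [ENNReal.toReal_ofReal', smul_eq_mul, Real.norm_eq_abs, abs_mul]
        rw [mul_comm]
        refine mul_le_mul_of_nonneg_left ?_ (abs_nonneg _)
        rcases le_total (h y) 0 with h0 | h0 <;> simp [h0]
    · refine (hI c).abs.mono' ?_ (Eventually.of_forall fun y => ?_)
      · exact (hm.neg.ennreal_ofReal.ennreal_toReal.aestronglyMeasurable).smul (hψ c).1
      · simp only [ENNReal.toReal_ofReal', smul_eq_mul, Real.norm_eq_abs, abs_mul, Pi.neg_apply]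
        rw [mul_comm]
        refine mul_le_mul_of_nonneg_left ?_ (abs_nonneg _)
        rcases le_total (h y) 0 with h0 | h0 <;> simp [h0, abs_of_nonpos]
  rw [withDensity_eq_iff hm.ennreal_ofReal.aemeasurable hm.neg.ennreal_ofReal.aemeasurable
    (by
      have := hfin _ hint
      rw [← setLIntegral_univ, ← withDensity_apply _ .univ]
      exact measure_ne_top _ _)] at heq
  rw [Lp.eq_zero_iff_ae_eq_zero]
  filter_upwards [heq] with y hy
  simp only [Pi.neg_apply, Pi.zero_apply] at hy ⊢
  rcases le_total (h y) 0 with h0 | h0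
  · rw [ENNReal.ofReal_of_nonpos h0] at hy
    have := ENNReal.ofReal_eq_zero.1 hy.symm
    linarith
  · rw [ENNReal.ofReal_of_nonpos (by linarith : -h y ≤ 0)] at hy
    have := ENNReal.ofReal_eq_zero.1 hy
    linarith

theorem tendsto_inner_zero_of_dense_span {E : Type*} [NormedAddCommGroup E] [InnerProductSpace ℝ E]
    {C : Type*} {l : Filter ℕ} {e : C → E}
    (he : (Submodule.span ℝ (Set.range e)).topologicalClosure = ⊤) {F : ℕ → E} {B : ℝ}
    (hB : ∀ k, ‖F k‖ ≤ B) (hF : ∀ c, Tendsto (fun k => inner ℝ (F k) (e c)) l (𝓝 0)) (h : E) :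
    Tendsto (fun k => inner ℝ (F k) h) l (𝓝 0) := by
  have hspan : ∀ g ∈ Submodule.span ℝ (Set.range e),
      Tendsto (fun k => inner ℝ (F k) g) l (𝓝 0) := by
    intro g hg
    induction hg using Submodule.span_induction with
    | mem x hx =>
      obtain ⟨c, rfl⟩ := hx
      exact hF c
    | zero => simpa using tendsto_const_nhds
    | add x y _ _ hx hy => simpa [inner_add_right] using hx.add hy
    | smul r x _ hx => simpa [inner_smul_right] using hx.const_mul r
  have hB' : 0 < |B| + 1 := by positivity
  rw [Metric.tendsto_nhds]
  intro δ hδ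
  have hmem : h ∈ closure (Submodule.span ℝ (Set.range e) : Set E) := by
    rw [← Submodule.topologicalClosure_coe, he]
    trivial
  obtain ⟨g, hg, hgh⟩ := Metric.mem_closure_iff.1 hmem (δ / 2 / (|B| + 1)) (by positivity)
  filter_upwards [Metric.tendsto_nhds.1 (hspan g hg) (δ / 2) (by positivity)] with k hk
  rw [dist_zero_right, Real.norm_eq_abs] at hk ⊢
  have e1 : inner ℝ (F k) h = inner ℝ (F k) g + inner ℝ (F k) (h - g) := by
    rw [← inner_add_right]
    simp
  have e2 : |inner ℝ (F k) (h - g)| ≤ (|B| + 1) * ‖h - g‖ := by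
    refine (abs_real_inner_le_norm _ _).trans (mul_le_mul_of_nonneg_right ?_ (norm_nonneg _))
    have := hB k
    have := le_abs_self B
    linarith
  rw [dist_eq_norm, lt_div_iff₀ hB'] at hgh
  rw [e1]
  have := abs_add_le (inner ℝ (F k) g) (inner ℝ (F k) (h - g))
  linarith

/-- If correlations of a measure-separating family of bounded functions tend to the product of the
means along some sequence of times, the transformation is ergodic: the restriction of `m` to an
invariant set is then a multiple of `m`. -/
theorem ergodic_of_tendsto_correlation {Y C : Type*} [MeasurableSpace Y] {m : Measure Y}
    [IsProbabilityMeasure m] {S : Y → Y} (hS : MeasurePreserving S m m) {ψ : C → Y → ℝ}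
    (hψm : ∀ c, Measurable (ψ c)) {B : ℝ} (hψB : ∀ c y, |ψ c y| ≤ B)
    (hsep : ∀ μ₁ μ₂ : Measure Y, IsFiniteMeasure μ₁ → IsFiniteMeasure μ₂ →
      (∀ c, ∫ y, ψ c y ∂μ₁ = ∫ y, ψ c y ∂μ₂) → μ₁ = μ₂)
    {l : Filter ℕ} [l.NeBot] {n : ℕ → ℕ}
    (hmix : ∀ c d, Tendsto (fun k => ∫ y, ψ c (S^[n k] y) * ψ d y ∂m) l
      (𝓝 ((∫ y, ψ c y ∂m) * ∫ y, ψ d y ∂m))) :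
    Ergodic S m := by
  refine ⟨hS, ⟨fun {A} hA hinv => ?_⟩⟩
  have hit : ∀ k, MeasurePreserving S^[k] m m := fun k => hS.iterate k
  have hbd : ∀ f : Y → ℝ, Measurable f → (∀ y, |f y| ≤ B) → MemLp f 2 m := fun f hf hfB =>
    MemLp.of_bound hf.aestronglyMeasurable B (Eventually.of_forall hfB)
  have hψ : ∀ c, MemLp (ψ c) 2 m := fun c => hbd _ (hψm c) (hψB c)
  have hψS : ∀ c k, MemLp (fun y => ψ c (S^[n k] y)) 2 m := fun c k =>
    hbd _ ((hψm c).comp (hit _).measurable) fun y => hψB c _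
  have hone : MemLp (fun _ : Y => (1 : ℝ)) 2 m := memLp_const 1
  have hdense := topologicalClosure_span_eq_top_of_separating hψ hsep
  have hinner : ∀ {f g : Y → ℝ} (hf : MemLp f 2 m) (hg : MemLp g 2 m),
      inner ℝ hf.toLp hg.toLp = ∫ y, f y * g y ∂m := by
    intro f g hf hg
    rw [L2.inner_def]
    refine integral_congr_ae ?_
    filter_upwards [hf.coeFn_toLp, hg.coeFn_toLp] with y h1 h2
    rw [h1, h2]
    simp [mul_comm]
  have hnorm : ∀ {f : Y → ℝ} (hf : MemLp f 2 m), (∀ y, |f y| ≤ B) → ‖hf.toLp‖ ≤ |B| := by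
    intro f hf hfB
    rw [Lp.norm_toLp]
    refine ENNReal.toReal_le_of_le_ofReal (abs_nonneg B) ?_
    refine (eLpNorm_le_of_ae_bound (C := |B|)
      (Eventually.of_forall fun y => (hfB y).trans (le_abs_self B))).trans ?_
    simp
  have hA2 : MemLp (A.indicator fun _ => (1 : ℝ)) 2 m := hone.indicator hA
  have key : ∀ c, ∫ y in A, ψ c y ∂m = (m A).toReal * ∫ y, ψ c y ∂m := by
    intro c
    have ht := tendsto_inner_zero_of_dense_span (l := l) hdense
      (F := fun k => (hψS c k).toLp - (∫ y, ψ c y ∂m) • hone.toLp)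
      (B := |B| + ‖(∫ y, ψ c y ∂m) • hone.toLp‖)
      (fun k => (norm_sub_le _ _).trans (by gcongr; exact hnorm _ fun y => hψB c _))
      (fun d => by
        simp only [inner_sub_left, inner_smul_left, hinner]
        have := (hmix c d).sub_const ((∫ y, ψ c y ∂m) * ∫ y, ψ d y ∂m)
        simpa using this) hA2.toLp
    simp only [inner_sub_left, inner_smul_left, hinner] at ht
    -- Invariance of `A` makes the correlations with its indicator constant in time.
    have e1 : ∀ k, ∫ y, ψ c (S^[n k] y) * A.indicator (fun _ => (1 : ℝ)) y ∂m =
        ∫ y in A, ψ c y ∂m := by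
      intro k
      have hpre : ∀ j, S^[j] ⁻¹' A = A := by
        intro j
        induction j with
        | zero => rfl
        | succ j ih => rw [Function.iterate_succ, Set.preimage_comp, ih, hinv]
      have h1 := setIntegral_map (μ := m) hA (f := ψ c) (g := S^[n k])
        (by rw [(hit _).map_eq]; exact (hψm c).aestronglyMeasurable) (hit _).measurable.aemeasurable
      rw [(hit _).map_eq, hpre] at h1
      rw [h1, ← integral_indicator hA]
      refine integral_congr_ae (Eventually.of_forall fun y => ?_)
      by_cases hy : y ∈ A <;> simp [hy]
    have e2 : ∫ y, (1 : ℝ) * A.indicator (fun _ => (1 : ℝ)) y ∂m = (m A).toReal := by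
      simp only [one_mul]
      rw [integral_indicator hA]
      simp [Measure.real]
    simp only [e1, e2] at ht
    have := tendsto_nhds_unique ht tendsto_const_nhds
    simp at this
    linarith
  have heq := hsep (m.restrict A) ((m A) • m) inferInstance
    ⟨by simp⟩ fun c => by
      rw [key, integral_smul_measure, smul_eq_mul]
  have h0 := congrArg (fun μ' : Measure Y => μ' Aᶜ) heq
  simp only [Measure.smul_apply, smul_eq_mul] at h0
  rw [Measure.restrict_apply hA.compl, Set.compl_inter_self, measure_empty, eq_comm,
    mul_eq_zero] at h0
  rw [eventuallyConst_set']
  rcases h0 with h0 | h0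
  · exact Or.inl (ae_eq_empty.2 h0)
  · exact Or.inr (ae_eq_univ.2 h0)

/-! ### Weak mixing of stationary Gaussian processes -/

/-- The real character `cas t = cos t + sin t`: it carries the same information as `e^{it}`, and
products of its values have the expansion `cas s * cas t = cos (s - t) + sin (s + t)`. -/
noncomputable def cas (t : ℝ) : ℝ := Real.cos t + Real.sin t

theorem cas_mul_cas (s t : ℝ) : cas s * cas t = Real.cos (s - t) + Real.sin (s + t) := by
  rw [cas, cas, Real.cos_sub, Real.sin_add]
  ring

theorem measurable_cas : Measurable cas := Real.measurable_cos.add Real.measurable_sin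

theorem abs_cas_le (t : ℝ) : |cas t| ≤ 2 := by
  have h1 := abs_add_le (Real.cos t) (Real.sin t)
  have h2 := Real.abs_cos_le_one t
  have h3 := Real.abs_sin_le_one t
  rw [cas]
  linarith

section TrigIntegrals

variable {Y : Type*} [MeasurableSpace Y] {m : Measure Y} [IsFiniteMeasure m] {f : Y → ℝ}

theorem integrable_cos_comp (hf : Measurable f) : Integrable (fun y => Real.cos (f y)) m :=
  Integrable.of_bound (C := 1) (Real.measurable_cos.comp hf).aestronglyMeasurable
    (Eventually.of_forall fun _ => Real.abs_cos_le_one _)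

theorem integrable_sin_comp (hf : Measurable f) : Integrable (fun y => Real.sin (f y)) m :=
  Integrable.of_bound (C := 1) (Real.measurable_sin.comp hf).aestronglyMeasurable
    (Eventually.of_forall fun _ => Real.abs_sin_le_one _)

theorem integral_exp_mul_I_eq (hf : Measurable f) :
    ∫ y, Complex.exp (f y * Complex.I) ∂m =
      (∫ y, Real.cos (f y) ∂m : ℝ) + (∫ y, Real.sin (f y) ∂m : ℝ) * Complex.I := by
  have e : ∀ y, Complex.exp (f y * Complex.I) =
      (Real.cos (f y) : ℂ) + (Real.sin (f y) : ℂ) * Complex.I := fun y => by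
    rw [Complex.exp_mul_I, Complex.ofReal_cos, Complex.ofReal_sin]
  simp_rw [e]
  rw [integral_add (integrable_cos_comp hf).ofReal ((integrable_sin_comp hf).ofReal.mul_const _),
    integral_mul_const, integral_complex_ofReal, integral_complex_ofReal]

theorem integral_cas_comp (hf : Measurable f) :
    ∫ y, cas (f y) ∂m = ∫ y, Real.cos (f y) ∂m + ∫ y, Real.sin (f y) ∂m :=
  integral_add (integrable_cos_comp hf) (integrable_sin_comp hf)

end TrigIntegrals

/-- A finite measure on sequence space is determined by its characteristic functional. -/
theorem ext_of_integral_exp_linearCombination {ι : Type*} {μ₁ μ₂ : Measure (ι → ℝ)}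
    [IsFiniteMeasure μ₁] [IsFiniteMeasure μ₂]
    (h : ∀ a : ι →₀ ℝ, ∫ x, Complex.exp ((Finsupp.linearCombination ℝ x a : ℝ) * Complex.I) ∂μ₁ =
      ∫ x, Complex.exp ((Finsupp.linearCombination ℝ x a : ℝ) * Complex.I) ∂μ₂) : μ₁ = μ₂ := by
  classical
  refine IsProjectiveLimit.unique (P := fun I => μ₂.map I.restrict) (fun I => ?_) fun I => rfl
  refine Measure.ext_of_charFunDual ?_
  ext L
  have hL : ∀ x : ι → ℝ, L (I.restrict x) = Finsupp.linearCombination ℝ x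
      (∑ i : I, Finsupp.single (i : ι) (L (Pi.single i 1))) := by
    intro x
    rw [map_sum]
    have hx : I.restrict x = ∑ i : I, x i • (Pi.single i 1 : I → ℝ) := by
      funext j
      simp [Finset.sum_apply, Pi.single_apply]
    rw [hx, map_sum]
    refine Finset.sum_congr rfl fun i _ => ?_
    rw [Finsupp.linearCombination_single, map_smul, smul_eq_mul, smul_eq_mul, mul_comm]
  rw [charFunDual_apply, charFunDual_apply,
    integral_map (I.measurable_restrict).aemeasurable (by fun_prop),
    integral_map (I.measurable_restrict).aemeasurable (by fun_prop)]
  simp only [hL]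
  exact h _

/-- The even and odd parts of `cas` recover cosine and sine. -/
theorem integral_exp_eq_of_integral_cas {Y : Type*} [MeasurableSpace Y]
    {μ₁ μ₂ : Measure Y} [IsFiniteMeasure μ₁] [IsFiniteMeasure μ₂] {f : Y → ℝ} (hf : Measurable f)
    (h : ∫ y, cas (f y) ∂μ₁ = ∫ y, cas (f y) ∂μ₂)
    (h' : ∫ y, cas (-f y) ∂μ₁ = ∫ y, cas (-f y) ∂μ₂) :
    ∫ y, Complex.exp (f y * Complex.I) ∂μ₁ = ∫ y, Complex.exp (f y * Complex.I) ∂μ₂ := by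
  rw [integral_cas_comp hf, integral_cas_comp hf] at h
  rw [integral_cas_comp (f := fun y => -f y) hf.neg,
    integral_cas_comp (f := fun y => -f y) hf.neg] at h'
  simp only [Real.cos_neg, Real.sin_neg, integral_neg] at h'
  rw [integral_exp_mul_I_eq hf, integral_exp_mul_I_eq hf]
  have hcos : ∫ y, Real.cos (f y) ∂μ₁ = ∫ y, Real.cos (f y) ∂μ₂ := by linarith
  have hsin : ∫ y, Real.sin (f y) ∂μ₁ = ∫ y, Real.sin (f y) ∂μ₂ := by linarith
  rw [hcos, hsin]

theorem ext_of_integral_cas {ι : Type*} {μ₁ μ₂ : Measure (ι → ℝ)}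
    [IsFiniteMeasure μ₁] [IsFiniteMeasure μ₂]
    (h : ∀ a : ι →₀ ℝ, ∫ x, cas (Finsupp.linearCombination ℝ x a) ∂μ₁ =
      ∫ x, cas (Finsupp.linearCombination ℝ x a) ∂μ₂) : μ₁ = μ₂ := by
  refine ext_of_integral_exp_linearCombination fun a =>
    integral_exp_eq_of_integral_cas (measurable_linearCombination a) (h a) ?_
  have := h (-a)
  simpa only [map_neg] using this

theorem linearCombination_sumElim {ι κ : Type*} (a : ι ⊕ κ →₀ ℝ) :
    ∃ (b : ι →₀ ℝ) (c : κ →₀ ℝ), ∀ (x : ι → ℝ) (y : κ → ℝ),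
      Finsupp.linearCombination ℝ (Sum.elim x y) a =
        Finsupp.linearCombination ℝ x b + Finsupp.linearCombination ℝ y c := by
  induction a using Finsupp.induction_linear with
  | zero => exact ⟨0, 0, fun x y => by simp⟩
  | add a a' h h' =>
    obtain ⟨b, c, h⟩ := h
    obtain ⟨b', c', h'⟩ := h'
    refine ⟨b + b', c + c', fun x y => ?_⟩
    rw [map_add, map_add, map_add, h, h']
    ring
  | single i r =>
    rcases i with i | i
    · exact ⟨Finsupp.single i r, 0, fun x y => by simp⟩
    · exact ⟨0, Finsupp.single i r, fun x y => by simp⟩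

/-- The determination of measures by characters on a product of two sequence spaces, regarded as
one sequence space over the disjoint union of the index sets. -/
theorem prod_ext_of_integral_cas {ι κ : Type*} {μ₁ μ₂ : Measure ((ι → ℝ) × (κ → ℝ))}
    [IsFiniteMeasure μ₁] [IsFiniteMeasure μ₂]
    (h : ∀ (a : ι →₀ ℝ) (b : κ →₀ ℝ),
      ∫ z, cas (Finsupp.linearCombination ℝ z.1 a + Finsupp.linearCombination ℝ z.2 b) ∂μ₁ =
      ∫ z, cas (Finsupp.linearCombination ℝ z.1 a + Finsupp.linearCombination ℝ z.2 b) ∂μ₂) :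
    μ₁ = μ₂ := by
  let e := (MeasurableEquiv.sumPiEquivProdPi fun _ : ι ⊕ κ => ℝ).symm
  have he : ∀ z, e z = Sum.elim z.1 z.2 := by
    intro z
    funext i
    rcases i with i | i <;> rfl
  have key : μ₁.map e = μ₂.map e := by
    have i1 : IsFiniteMeasure (μ₁.map e) := Measure.isFiniteMeasure_map _ _
    have i2 : IsFiniteMeasure (μ₂.map e) := Measure.isFiniteMeasure_map _ _
    refine ext_of_integral_cas fun a => ?_
    obtain ⟨b, c, hbc⟩ := linearCombination_sumElim a
    rw [integral_map_equiv, integral_map_equiv]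
    simp only [he, hbc]
    exact h b c
  have := congrArg (Measure.map e.symm) key
  simpa [Measure.map_map e.symm.measurable e.measurable] using this

theorem integral_cos_sin_gaussianReal (v : NNReal) :
    ∫ x, Real.cos x ∂(ProbabilityTheory.gaussianReal 0 v) = Real.exp (-(v / 2)) ∧
    ∫ x, Real.sin x ∂(ProbabilityTheory.gaussianReal 0 v) = 0 := by
  have h := ProbabilityTheory.charFun_gaussianReal (μ := 0) (v := v) 1
  rw [charFun_apply_real] at h
  simp only [Complex.ofReal_one, one_mul] at h
  rw [integral_exp_mul_I_eq (f := fun x => x) measurable_id] at h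
  have e : Complex.exp (((0 : ℝ) : ℂ) * Complex.I - ((v : ℝ) : ℂ) * 1 ^ 2 / 2) =
      (Real.exp (-(v / 2)) : ℝ) := by
    push_cast
    congr 1
    ring
  rw [e] at h
  have hr := congrArg Complex.re h
  have hi := congrArg Complex.im h
  simp only [Complex.add_re, Complex.add_im, Complex.ofReal_re, Complex.ofReal_im, Complex.mul_re,
    Complex.mul_im, Complex.I_re, Complex.I_im] at hr hi
  constructor <;> linarith

/-- The shift `(T x) i = x (i + 1)` on two-sided real sequences. -/
def intShift : (ℤ → ℝ) ≃ᵐ (ℤ → ℝ) where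
  toFun x i := x (i + 1)
  invFun x i := x (i - 1)
  left_inv x := by simp
  right_inv x := by simp
  measurable_toFun := measurable_pi_lambda _ fun i => measurable_pi_apply (i + 1)
  measurable_invFun := measurable_pi_lambda _ fun i => measurable_pi_apply (i - 1)

theorem intShift_apply (x : ℤ → ℝ) (i : ℤ) : intShift x i = x (i + 1) := rfl

theorem intShift_zpow_apply (n : ℤ) (x : ℤ → ℝ) (i : ℤ) :
    (intShift.toEquiv ^ n : Equiv.Perm (ℤ → ℝ)) x i = x (i + n) := by
  induction n generalizing x i with
  | zero => simp
  | succ n ih =>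
    rw [zpow_add, zpow_one, Equiv.Perm.mul_apply, ih]
    change x (i + n + 1) = _
    rw [add_assoc]
  | pred n ih =>
    rw [zpow_sub, zpow_one, Equiv.Perm.mul_apply, ih]
    change x (i + -n - 1) = _
    congr 1
    ring

theorem intShift_iterate_apply (n : ℕ) (x : ℤ → ℝ) (i : ℤ) : intShift^[n] x i = x (i + n) := by
  induction n generalizing x with
  | zero => simp
  | succ n ih =>
    rw [Function.iterate_succ_apply, ih, intShift_apply]
    push_cast
    rw [add_assoc]

section Gaussian

variable {H : Type*} [NormedAddCommGroup H] [InnerProductSpace ℝ H]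

theorem IsGaussianWithCovariance.integral_cos_sin {ι : Type*} {μ : Measure (ι → ℝ)} {v : ι → H}
    (hμ : IsGaussianWithCovariance μ v) (a : ι →₀ ℝ) :
    ∫ x, Real.cos (Finsupp.linearCombination ℝ x a) ∂μ =
        Real.exp (-(‖Finsupp.linearCombination ℝ v a‖ ^ 2 / 2)) ∧
      ∫ x, Real.sin (Finsupp.linearCombination ℝ x a) ∂μ = 0 := by
  have h := integral_cos_sin_gaussianReal (‖Finsupp.linearCombination ℝ v a‖₊ ^ 2)
  have hm := (measurable_linearCombination a).aemeasurable (μ := μ)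
  rw [← hμ a, integral_map hm Real.measurable_cos.aestronglyMeasurable,
    integral_map hm Real.measurable_sin.aestronglyMeasurable] at h
  simpa using h

theorem IsGaussianWithCovariance.integral_prod_cos_sin {ι : Type*} {μ : Measure (ι → ℝ)}
    [IsProbabilityMeasure μ] {v : ι → H} (hμ : IsGaussianWithCovariance μ v) (a b : ι →₀ ℝ) :
    ∫ z, Real.cos (Finsupp.linearCombination ℝ z.1 a + Finsupp.linearCombination ℝ z.2 b)
        ∂(μ.prod μ) =
        Real.exp (-(‖Finsupp.linearCombination ℝ v a‖ ^ 2 / 2)) *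
          Real.exp (-(‖Finsupp.linearCombination ℝ v b‖ ^ 2 / 2)) ∧
      ∫ z, Real.sin (Finsupp.linearCombination ℝ z.1 a + Finsupp.linearCombination ℝ z.2 b)
        ∂(μ.prod μ) = 0 := by
  obtain ⟨ca, sa⟩ := hμ.integral_cos_sin a
  obtain ⟨cb, sb⟩ := hμ.integral_cos_sin b
  have ma := measurable_linearCombination a
  have mb := measurable_linearCombination b
  have ica := integrable_cos_comp (m := μ) ma
  have isa := integrable_sin_comp (m := μ) ma
  have icb := integrable_cos_comp (m := μ) mb
  have isb := integrable_sin_comp (m := μ) mb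
  simp only [Real.cos_add, Real.sin_add]
  rw [integral_sub (ica.mul_prod icb) (isa.mul_prod isb),
    integral_add (isa.mul_prod icb) (ica.mul_prod isb)]
  rw [integral_prod_mul (fun x : ι → ℝ => Real.cos (Finsupp.linearCombination ℝ x a))
      (fun x : ι → ℝ => Real.cos (Finsupp.linearCombination ℝ x b)),
    integral_prod_mul (fun x : ι → ℝ => Real.sin (Finsupp.linearCombination ℝ x a))
      (fun x : ι → ℝ => Real.sin (Finsupp.linearCombination ℝ x b)),
    integral_prod_mul (fun x : ι → ℝ => Real.sin (Finsupp.linearCombination ℝ x a))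
      (fun x : ι → ℝ => Real.cos (Finsupp.linearCombination ℝ x b)),
    integral_prod_mul (fun x : ι → ℝ => Real.cos (Finsupp.linearCombination ℝ x a))
      (fun x : ι → ℝ => Real.sin (Finsupp.linearCombination ℝ x b)),
    ca, sa, cb, sb]
  simp

theorem linearCombination_intShift_iterate (n : ℕ) (x : ℤ → ℝ) (a : ℤ →₀ ℝ) :
    Finsupp.linearCombination ℝ (intShift^[n] x) a =
      Finsupp.linearCombination ℝ x (a.mapDomain (· + (n : ℤ))) := by
  rw [Finsupp.linearCombination_mapDomain]
  congr 2
  funext i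
  exact intShift_iterate_apply n x i

variable {v : ℤ → H} {c : ℤ → ℝ}

theorem inner_linearCombination {ι : Type*} (v w : ι → H) (a b : ι →₀ ℝ) :
    inner ℝ (Finsupp.linearCombination ℝ v a) (Finsupp.linearCombination ℝ w b) =
      ∑ i ∈ a.support, ∑ j ∈ b.support, a i * (b j * inner ℝ (v i) (w j)) := by
  simp only [Finsupp.linearCombination_apply, Finsupp.sum, sum_inner, inner_sum, inner_smul_left,
    inner_smul_right, Finset.mul_sum, conj_trivial]
  rw [Finset.sum_comm]
  refine Finset.sum_congr rfl fun i _ => Finset.sum_congr rfl fun j _ => ?_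
  ring

theorem inner_linearCombination_mapDomain (hc : ∀ i j, inner ℝ (v i) (v j) = c (i - j)) (n : ℤ)
    (a b : ℤ →₀ ℝ) :
    inner ℝ (Finsupp.linearCombination ℝ v (a.mapDomain (· + n)))
      (Finsupp.linearCombination ℝ v b) =
      ∑ i ∈ a.support, ∑ j ∈ b.support, a i * (b j * c (n + (i - j))) := by
  rw [Finsupp.linearCombination_mapDomain, inner_linearCombination]
  simp only [Function.comp_apply, hc]
  refine Finset.sum_congr rfl fun i _ => Finset.sum_congr rfl fun j _ => ?_
  rw [show i + n - j = n + (i - j) by ring]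

theorem norm_linearCombination_mapDomain (hc : ∀ i j, inner ℝ (v i) (v j) = c (i - j)) (n : ℤ)
    (a : ℤ →₀ ℝ) : ‖Finsupp.linearCombination ℝ v (a.mapDomain (· + n))‖ ^ 2 =
      ‖Finsupp.linearCombination ℝ v a‖ ^ 2 := by
  rw [← real_inner_self_eq_norm_sq, ← real_inner_self_eq_norm_sq,
    Finsupp.linearCombination_mapDomain, inner_linearCombination, inner_linearCombination]
  simp only [Function.comp_apply, hc, add_sub_add_right_eq_sub]

/-- A stationary Gaussian process whose covariances tend to zero along a sequence of times is
weakly mixing: characters of the product system decorrelate, because the covariance of a shifted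
and an unshifted finite combination is a finite sum of terms that tend to zero. -/
theorem isWeaklyMixing_intShift {μ : Measure (ℤ → ℝ)} [IsProbabilityMeasure μ]
    (hμ : IsGaussianWithCovariance μ v) (hc : ∀ i j, inner ℝ (v i) (v j) = c (i - j))
    {l : Filter ℕ} [l.NeBot] {n : ℕ → ℕ} (hn : ∀ j : ℤ, Tendsto (fun k => c (n k + j)) l (𝓝 0)) :
    IsWeaklyMixing intShift μ := by
  have hT : MeasurePreserving intShift μ μ := by
    refine ⟨intShift.measurable, ?_⟩
    have := Measure.isProbabilityMeasure_map (μ := μ) intShift.measurable.aemeasurable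
    refine ext_of_integral_cas fun a => ?_
    rw [integral_map_equiv]
    have e := fun x => linearCombination_intShift_iterate 1 x a
    simp only [Function.iterate_one] at e
    simp only [e]
    rw [integral_cas_comp (measurable_linearCombination _),
      integral_cas_comp (measurable_linearCombination _), (hμ.integral_cos_sin _).1,
      (hμ.integral_cos_sin _).1, (hμ.integral_cos_sin _).2, (hμ.integral_cos_sin _).2,
      norm_linearCombination_mapDomain hc]
  refine ⟨hT, ?_⟩
  let ψ : (ℤ →₀ ℝ) × (ℤ →₀ ℝ) → (ℤ → ℝ) × (ℤ → ℝ) → ℝ := fun p z =>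
    cas (Finsupp.linearCombination ℝ z.1 p.1 + Finsupp.linearCombination ℝ z.2 p.2)
  have hlm : ∀ a b : ℤ →₀ ℝ, Measurable fun z : (ℤ → ℝ) × (ℤ → ℝ) =>
      Finsupp.linearCombination ℝ z.1 a + Finsupp.linearCombination ℝ z.2 b := fun a b =>
    ((measurable_linearCombination a).comp measurable_fst).add
      ((measurable_linearCombination b).comp measurable_snd)
  refine ergodic_of_tendsto_correlation (hT.prod hT) (ψ := ψ) (B := 2) (l := l) (n := n)
    (fun p => measurable_cas.comp (hlm _ _)) (fun p z => abs_cas_le _)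
    (fun μ₁ μ₂ _ _ h => prod_ext_of_integral_cas fun a b => h (a, b)) ?_
  rintro ⟨a, b⟩ ⟨a', b'⟩
  have hmean : ∀ a b : ℤ →₀ ℝ, ∫ z, ψ (a, b) z ∂(μ.prod μ) =
      Real.exp (-(‖Finsupp.linearCombination ℝ v a‖ ^ 2 / 2)) *
        Real.exp (-(‖Finsupp.linearCombination ℝ v b‖ ^ 2 / 2)) := by
    intro a b
    simp only [ψ]
    rw [integral_cas_comp (hlm a b), (hμ.integral_prod_cos_sin a b).1,
      (hμ.integral_prod_cos_sin a b).2, add_zero]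
  have hcorr : ∀ k, ∫ z, ψ (a, b) ((Prod.map intShift intShift)^[n k] z) * ψ (a', b') z
      ∂(μ.prod μ) =
      Real.exp (-(‖Finsupp.linearCombination ℝ v (a.mapDomain (· + (n k : ℤ)) - a')‖ ^ 2 / 2)) *
      Real.exp (-(‖Finsupp.linearCombination ℝ v (b.mapDomain (· + (n k : ℤ)) - b')‖ ^ 2 / 2)) := by
    intro k
    have e : ∀ z, ψ (a, b) ((Prod.map intShift intShift)^[n k] z) * ψ (a', b') z =
        Real.cos (Finsupp.linearCombination ℝ z.1 (a.mapDomain (· + (n k : ℤ)) - a') +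
          Finsupp.linearCombination ℝ z.2 (b.mapDomain (· + (n k : ℤ)) - b')) +
        Real.sin (Finsupp.linearCombination ℝ z.1 (a.mapDomain (· + (n k : ℤ)) + a') +
          Finsupp.linearCombination ℝ z.2 (b.mapDomain (· + (n k : ℤ)) + b')) := by
      intro z
      simp only [ψ]
      rw [Prod.map_iterate, cas_mul_cas, Prod.map_fst, Prod.map_snd,
        linearCombination_intShift_iterate, linearCombination_intShift_iterate, map_sub, map_sub,
        map_add, map_add]
      congr 2 <;> ring
    simp only [e]
    rw [integral_add (integrable_cos_comp (hlm _ _)) (integrable_sin_comp (hlm _ _)),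
      (hμ.integral_prod_cos_sin _ _).1, (hμ.integral_prod_cos_sin _ _).2, add_zero]
  have hlim : ∀ a a' : ℤ →₀ ℝ, Tendsto (fun k =>
      Real.exp (-(‖Finsupp.linearCombination ℝ v (a.mapDomain (· + (n k : ℤ)) - a')‖ ^ 2 / 2))) l
      (𝓝 (Real.exp (-(‖Finsupp.linearCombination ℝ v a‖ ^ 2 / 2)) *
        Real.exp (-(‖Finsupp.linearCombination ℝ v a'‖ ^ 2 / 2)))) := by
    intro a a'
    have h0 : Tendsto (fun k => inner ℝ
        (Finsupp.linearCombination ℝ v (a.mapDomain (· + (n k : ℤ))))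
        (Finsupp.linearCombination ℝ v a')) l (𝓝 0) := by
      simp only [inner_linearCombination_mapDomain hc]
      have := tendsto_finsetSum a.support fun i _ => tendsto_finsetSum a'.support fun j _ =>
        ((hn (i - j)).const_mul (a' j)).const_mul (a i)
      simpa using this
    rw [← Real.exp_add]
    refine (Real.continuous_exp.tendsto _).comp ?_
    have h1 := h0.add_const (-(‖Finsupp.linearCombination ℝ v a‖ ^ 2 / 2) +
      -(‖Finsupp.linearCombination ℝ v a'‖ ^ 2 / 2))
    rw [zero_add] at h1
    refine h1.congr fun k => ?_
    rw [map_sub, norm_sub_sq_real, norm_linearCombination_mapDomain hc]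
    ring
  rw [hmean, hmean]
  simp only [hcorr]
  rw [mul_mul_mul_comm]
  exact (hlim a a').mul (hlim b b')

end Gaussian

/-! ### Wiener's lemma for non-atomic measures on the circle -/

theorem fourier_eq_pow_mul (i : ℕ) (j : ℤ) (w : UnitAddCircle) :
    fourier ((i : ℤ) + j) w = fourier 1 w ^ i * fourier j w := by
  rw [fourier_add, fourier_apply, fourier_apply, fourier_apply, one_smul, natCast_zsmul,
    AddCircle.toCircle_nsmul, Circle.coe_pow]

theorem norm_fourier_apply (n : ℤ) (w : UnitAddCircle) : ‖fourier n w‖ = 1 := by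
  rw [fourier_apply]
  exact Circle.norm_coe _

theorem fourier_one_ne_one {w : UnitAddCircle} (hw : w ≠ 0) : fourier 1 w ≠ (1 : ℂ) := by
  intro h
  rw [fourier_one] at h
  refine hw (AddCircle.injective_toCircle one_ne_zero ?_)
  rw [AddCircle.toCircle_zero]
  exact Circle.ext h

theorem norm_geom_sum_mul_le {z : ℂ} (hz : ‖z‖ = 1) (N : ℕ) :
    ‖∑ i ∈ Finset.range N, z ^ i‖ * ‖z - 1‖ ≤ 2 := by
  rw [← norm_mul, geom_sum_mul]
  refine (norm_sub_le _ _).trans ?_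
  rw [norm_pow, hz, one_pow, norm_one]
  norm_num

theorem tendsto_average_fourier (j : ℤ) {w : UnitAddCircle} (hw : w ≠ 0) :
    Tendsto (fun N : ℕ => (N : ℂ)⁻¹ * ∑ i ∈ Finset.range N, fourier ((i : ℤ) + j) w) atTop
      (𝓝 0) := by
  have hd : 0 < ‖fourier 1 w - 1‖ := norm_pos_iff.2 (sub_ne_zero.2 (fourier_one_ne_one hw))
  have h := (tendsto_inv_atTop_nhds_zero_nat (𝕜 := ℝ)).mul_const (2 / ‖fourier 1 w - 1‖)
  rw [zero_mul] at h
  refine squeeze_zero_norm (fun N => ?_) h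
  have h2 := norm_geom_sum_mul_le (norm_fourier_apply 1 w) N
  rw [← le_div_iff₀ hd] at h2
  simp only [fourier_eq_pow_mul, ← Finset.sum_mul]
  rw [norm_mul, norm_mul, norm_fourier_apply, mul_one, norm_inv, Complex.norm_natCast]
  gcongr

theorem conj_integral_fourier (ν : Measure UnitAddCircle) (n : ℤ) :
    (starRingEnd ℂ) (∫ u, fourier n u ∂ν) = ∫ u, fourier (-n) u ∂ν := by
  rw [← integral_conj]
  simp only [fourier_neg]

section Wiener

variable {ν : Measure UnitAddCircle} [IsProbabilityMeasure ν]

theorem integrable_fourier (n : ℤ) : Integrable (fun u => fourier n u) ν :=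
  Integrable.of_bound (C := 1) (fourier n).continuous.aestronglyMeasurable
    (Eventually.of_forall fun u => (norm_fourier_apply n u).le)

theorem norm_integral_fourier_sq (n : ℤ) : ((‖∫ u, fourier n u ∂ν‖ ^ 2 : ℝ) : ℂ) =
    ∫ z, fourier n (z.1 - z.2) ∂(ν.prod ν) := by
  have e : ∀ z : UnitAddCircle × UnitAddCircle,
      fourier n (z.1 - z.2) = fourier n z.1 * fourier (-n) z.2 := by
    intro z
    rw [fourier_apply, fourier_apply, fourier_apply, smul_sub, sub_eq_add_neg,
      AddCircle.toCircle_add, Circle.coe_mul, neg_smul]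
  simp only [e]
  rw [integral_prod_mul (fun u => (fourier n u : ℂ)) (fun u => (fourier (-n) u : ℂ)),
    ← conj_integral_fourier, Complex.mul_conj, Complex.normSq_eq_norm_sq]

theorem ae_fst_ne_snd [NullSingletonClass ν] :
    ∀ᵐ z : UnitAddCircle × UnitAddCircle ∂(ν.prod ν), z.1 - z.2 ≠ 0 := by
  have hm : MeasurableSet {z : UnitAddCircle × UnitAddCircle | z.1 - z.2 = 0} :=
    measurableSet_eq_fun (measurable_fst.sub measurable_snd) measurable_const
  have h0 : (ν.prod ν) {z | z.1 - z.2 = 0} = 0 := by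
    rw [Measure.measure_prod_null hm]
    refine Eventually.of_forall fun x => ?_
    have : Prod.mk x ⁻¹' {z : UnitAddCircle × UnitAddCircle | z.1 - z.2 = 0} = {x} := by
      ext y
      simp [sub_eq_zero, eq_comm]
    change ν (Prod.mk x ⁻¹' {z : UnitAddCircle × UnitAddCircle | z.1 - z.2 = 0}) = 0
    rw [this]
    exact measure_singleton x
  rw [ae_iff]
  simpa using h0

/-- Wiener's lemma: the mean of `|ν̂(i + j)|²` over `i < N` is the integral over `ν × ν` of a mean
of characters of `u - v`, which tends to zero off the diagonal, a null set. -/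
theorem tendsto_average_norm_integral_fourier_sq [NullSingletonClass ν] (j : ℤ) :
    Tendsto (fun N : ℕ => (N : ℝ)⁻¹ *
      ∑ i ∈ Finset.range N, ‖∫ u, fourier ((i : ℤ) + j) u ∂ν‖ ^ 2) atTop (𝓝 0) := by
  have hc : ∀ i : ℤ, Continuous fun z : UnitAddCircle × UnitAddCircle =>
      (fourier i (z.1 - z.2) : ℂ) := fun i =>
    (fourier i).continuous.comp (continuous_fst.sub continuous_snd)
  have hi : ∀ i : ℤ, Integrable (fun z : UnitAddCircle × UnitAddCircle =>
      (fourier i (z.1 - z.2) : ℂ)) (ν.prod ν) := fun i =>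
    Integrable.of_bound (C := 1) (hc i).aestronglyMeasurable
      (Eventually.of_forall fun z => (norm_fourier_apply i _).le)
  have h := tendsto_integral_of_dominated_convergence (μ := ν.prod ν)
    (F := fun (N : ℕ) z => (N : ℂ)⁻¹ * ∑ i ∈ Finset.range N, fourier ((i : ℤ) + j) (z.1 - z.2))
    (f := fun _ => 0) (fun _ => 1)
    (fun N => (continuous_const.mul
      (continuous_finsetSum _ fun i _ => hc _)).aestronglyMeasurable)
    (integrable_const 1)
    (fun N => Eventually.of_forall fun z => by
      rw [norm_mul, norm_inv, Complex.norm_natCast]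
      have : ‖∑ i ∈ Finset.range N, fourier ((i : ℤ) + j) (z.1 - z.2)‖ ≤ N := by
        refine (norm_sum_le _ _).trans ?_
        simp only [norm_fourier_apply, Finset.sum_const, Finset.card_range, nsmul_eq_mul, mul_one,
          le_refl]
      exact (mul_le_mul_of_nonneg_left this (by positivity)).trans inv_mul_le_one)
    (by
      filter_upwards [ae_fst_ne_snd (ν := ν)] with z hz
      exact tendsto_average_fourier j hz)
  rw [integral_zero] at h
  have e : ∀ N : ℕ, ∫ z, (N : ℂ)⁻¹ * ∑ i ∈ Finset.range N, fourier ((i : ℤ) + j) (z.1 - z.2)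
      ∂(ν.prod ν) = (((N : ℝ)⁻¹ *
        ∑ i ∈ Finset.range N, ‖∫ u, fourier ((i : ℤ) + j) u ∂ν‖ ^ 2 : ℝ) : ℂ) := by
    intro N
    rw [integral_const_mul, integral_finsetSum _ fun i _ => hi _]
    simp only [← norm_integral_fourier_sq]
    push_cast
    rfl
  simp only [e] at h
  rw [← Complex.ofReal_zero] at h
  exact Filter.tendsto_ofReal_iff.1 h

/-- The Fourier coefficients of a non-atomic measure, and all their fixed translates, tend to zero
along a common sequence of times. -/
theorem exists_tendsto_integral_fourier [NullSingletonClass ν] :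
    ∃ n : ℕ → ℕ, ∀ j : ℤ,
      Tendsto (fun k => ∫ u, fourier ((n k : ℤ) + j) u ∂ν) atTop (𝓝 0) := by
  have hex : ∀ J : ℕ, ∃ i : ℕ, ∑ j ∈ Finset.Icc (-(J : ℤ)) J,
      ‖∫ u, fourier ((i : ℤ) + j) u ∂ν‖ ^ 2 < 1 / ((J : ℝ) + 1) := by
    intro J
    by_contra! hall
    have h := tendsto_finsetSum (Finset.Icc (-(J : ℤ)) J) fun j _ =>
      tendsto_average_norm_integral_fourier_sq (ν := ν) j
    rw [Finset.sum_const_zero] at h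
    have hpos : 0 < 1 / ((J : ℝ) + 1) := by positivity
    obtain ⟨N, hN, hN0⟩ := ((h.eventually (gt_mem_nhds hpos)).and (eventually_gt_atTop 0)).exists
    rw [← Finset.mul_sum, Finset.sum_comm] at hN
    have h2 : (N : ℝ) * (1 / ((J : ℝ) + 1)) ≤ ∑ i ∈ Finset.range N,
        ∑ j ∈ Finset.Icc (-(J : ℤ)) J, ‖∫ u, fourier ((i : ℤ) + j) u ∂ν‖ ^ 2 := by
      have := Finset.card_nsmul_le_sum (Finset.range N) _ _ fun i _ => hall i
      simpa using this
    have hN' : (0 : ℝ) < N := by exact_mod_cast hN0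
    rw [inv_mul_lt_iff₀ hN'] at hN
    linarith
  -- At time `n J` all translates `|j| ≤ J` are small at once.
  choose n hn using hex
  refine ⟨n, fun j => ?_⟩
  have hsq : Tendsto (fun k => ‖∫ u, fourier ((n k : ℤ) + j) u ∂ν‖ ^ 2) atTop (𝓝 0) := by
    refine squeeze_zero' (Eventually.of_forall fun k => by positivity) ?_
      (tendsto_one_div_add_atTop_nhds_zero_nat (𝕜 := ℝ))
    filter_upwards [eventually_ge_atTop j.natAbs] with k hk
    refine le_trans ?_ (hn k).le
    refine Finset.single_le_sum (f := fun j : ℤ => ‖∫ u, fourier ((n k : ℤ) + j) u ∂ν‖ ^ 2)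
      (fun i _ => by positivity) (Finset.mem_Icc.2 ⟨by omega, by omega⟩)
  rw [tendsto_zero_iff_norm_tendsto_zero]
  have := hsq.sqrt
  simpa [Real.sqrt_sq] using this

end Wiener

/-! ### Averages of characters along `n N` -/

/-- The multiplier `(1/N) ∑_{n=1}^N e^{2πi n N u}` of the averages along `n N`. -/
noncomputable def charAverage (N : ℕ) (u : UnitAddCircle) : ℂ :=
  (N : ℂ)⁻¹ * ∑ n ∈ Finset.Icc 1 N, fourier ((n : ℤ) * N) u

theorem continuous_charAverage (N : ℕ) : Continuous (charAverage N) :=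
  continuous_const.mul (continuous_finsetSum _ fun _ _ => (fourier _).continuous)

theorem norm_charAverage_le_one (N : ℕ) (u : UnitAddCircle) : ‖charAverage N u‖ ≤ 1 := by
  rw [charAverage, norm_mul, norm_inv, Complex.norm_natCast]
  have : ‖∑ n ∈ Finset.Icc 1 N, fourier ((n : ℤ) * N) u‖ ≤ N := by
    refine (norm_sum_le _ _).trans ?_
    simp only [norm_fourier_apply, Finset.sum_const, Nat.card_Icc, add_tsub_cancel_right,
      nsmul_eq_mul, mul_one, le_refl]
  exact (mul_le_mul_of_nonneg_left this (by positivity)).trans inv_mul_le_one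

theorem fourier_mul_eq_pow (n N : ℕ) (u : UnitAddCircle) :
    fourier ((n : ℤ) * N) u = (fourier 1 u ^ N) ^ n := by
  have h := fourier_eq_pow_mul (n * N) 0 u
  rw [fourier_zero, mul_one, add_zero] at h
  rw [← pow_mul, mul_comm N n, ← h]
  push_cast
  rfl

theorem norm_charAverage_mul_le (N : ℕ) (u : UnitAddCircle) :
    ‖charAverage N u‖ * ‖(fourier 1 u : ℂ) ^ N - 1‖ ≤ 2 * (N : ℝ)⁻¹ := by
  have hz : ‖(fourier 1 u : ℂ) ^ N‖ = 1 := by rw [norm_pow, norm_fourier_apply, one_pow]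
  have h := norm_geom_sum_mul_le hz N
  have e : ∑ n ∈ Finset.Icc 1 N, fourier ((n : ℤ) * N) u =
      (∑ i ∈ Finset.range N, ((fourier 1 u : ℂ) ^ N) ^ i) * (fourier 1 u : ℂ) ^ N := by
    rw [Finset.sum_mul, Finset.range_eq_Ico, ← Finset.Ico_add_one_right_eq_Icc,
      Finset.sum_Ico_eq_sum_range, ← Finset.range_eq_Ico, Nat.add_sub_cancel]
    refine Finset.sum_congr rfl fun i _ => ?_
    rw [fourier_mul_eq_pow, add_comm 1 i, pow_succ]
  rw [charAverage, e, norm_mul, norm_mul, hz, mul_one, norm_inv, Complex.norm_natCast, mul_assoc,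
    mul_comm 2]
  gcongr

/-- One of `z ^ N`, `z ^ (N + 1)` stays away from `1` when `z ≠ 1`, so the corresponding geometric
sum is bounded and consecutive averages cannot both be large. -/
theorem tendsto_charAverage_mul_succ {u : UnitAddCircle} (hu : u ≠ 0) :
    Tendsto (fun N => ‖charAverage N u‖ * ‖charAverage (N + 1) u‖) atTop (𝓝 0) := by
  set z : ℂ := fourier 1 u with hzd
  have hz : ‖z‖ = 1 := norm_fourier_apply 1 u
  have hd : 0 < ‖z - 1‖ := norm_pos_iff.2 (sub_ne_zero.2 (fourier_one_ne_one hu))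
  have h := (tendsto_inv_atTop_nhds_zero_nat (𝕜 := ℝ)).mul_const (4 / ‖z - 1‖)
  rw [zero_mul] at h
  refine squeeze_zero' (Eventually.of_forall fun N => by positivity) ?_ h
  filter_upwards [eventually_gt_atTop 0] with N hN
  have hN' : (0 : ℝ) < N := by exact_mod_cast hN
  have h1 := norm_charAverage_mul_le N u
  have h2 := norm_charAverage_mul_le (N + 1) u
  rw [← hzd] at h1 h2
  have hinv : (((N + 1 : ℕ) : ℝ))⁻¹ ≤ (N : ℝ)⁻¹ := by
    gcongr
    exact N.le_succ
  have hsum : ‖z - 1‖ ≤ ‖z ^ (N + 1) - 1‖ + ‖z ^ N - 1‖ := by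
    have e : z ^ N * (z - 1) = (z ^ (N + 1) - 1) - (z ^ N - 1) := by ring
    have := norm_sub_le (z ^ (N + 1) - 1) (z ^ N - 1)
    rwa [← e, norm_mul, norm_pow, hz, one_pow, one_mul] at this
  have a0 := norm_nonneg (charAverage N u)
  have b0 := norm_nonneg (charAverage (N + 1) u)
  have a1 := norm_charAverage_le_one N u
  have b1 := norm_charAverage_le_one (N + 1) u
  rw [← mul_div_assoc, le_div_iff₀ hd]
  set a := ‖charAverage N u‖
  set b := ‖charAverage (N + 1) u‖
  calc a * b * ‖z - 1‖ ≤ a * b * (‖z ^ (N + 1) - 1‖ + ‖z ^ N - 1‖) := by gcongr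
    _ = a * (b * ‖z ^ (N + 1) - 1‖) + b * (a * ‖z ^ N - 1‖) := by ring
    _ ≤ 1 * (b * ‖z ^ (N + 1) - 1‖) + 1 * (a * ‖z ^ N - 1‖) := by gcongr
    _ ≤ (N : ℝ)⁻¹ * 4 := by linarith

theorem norm_fourier_one_sub_one_le (w : UnitAddCircle) :
    ‖(fourier 1 w : ℂ) - 1‖ ≤ 2 * Real.pi * ‖w‖ := by
  induction w using QuotientAddGroup.induction_on with
  | H x =>
    change ‖(fourier 1 (x : UnitAddCircle) : ℂ) - 1‖ ≤ 2 * Real.pi * ‖(x : UnitAddCircle)‖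
    have hx : (x : UnitAddCircle) = ((x - round x : ℝ) : UnitAddCircle) := by
      rw [AddCircle.coe_sub]
      have : ((round x : ℝ) : UnitAddCircle) = 0 := by
        rw [AddCircle.coe_eq_zero_iff]
        exact ⟨round x, by simp⟩
      rw [this, sub_zero]
    rw [UnitAddCircle.norm_eq]
    conv_lhs => rw [hx]
    rw [fourier_coe_apply]
    have e : 2 * (Real.pi : ℂ) * Complex.I * ((1 : ℤ) : ℂ) * ((x - round x : ℝ) : ℂ) / ((1 : ℝ) : ℂ)
        = Complex.I * ((2 * Real.pi * (x - round x) : ℝ) : ℂ) := by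
      push_cast
      ring
    rw [e]
    refine Real.norm_exp_I_mul_ofReal_sub_one_le.trans ?_
    rw [Real.norm_eq_abs, abs_mul, abs_of_pos (by positivity : 0 < 2 * Real.pi)]

/-- If `M u` is within `ε / M` of an integer, each term `e^{2πi n M u}` with `n ≤ M` is within `2πε`
of `1`. -/
theorem norm_charAverage_sub_one_le {ε : ℝ} {M : ℕ} (hM : 0 < M) {u : UnitAddCircle}
    (hu : ‖M • u‖ ≤ ε / M) : ‖charAverage M u - 1‖ ≤ 2 * Real.pi * ε := by
  have hM' : (0 : ℝ) < M := by exact_mod_cast hM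
  have hMc : (M : ℂ) ≠ 0 := by exact_mod_cast hM.ne'
  have e : charAverage M u - 1 =
      (M : ℂ)⁻¹ * ∑ n ∈ Finset.Icc 1 M, (fourier ((n : ℤ) * M) u - 1) := by
    rw [Finset.sum_sub_distrib, mul_sub, charAverage]
    simp [hMc]
  have hterm : ∀ n ∈ Finset.Icc 1 M, ‖(fourier ((n : ℤ) * M) u : ℂ) - 1‖ ≤ 2 * Real.pi * ε := by
    intro n hn
    have hn' : (n : ℝ) ≤ M := by exact_mod_cast (Finset.mem_Icc.1 hn).2
    have e1 : (fourier ((n : ℤ) * M) u : ℂ) = fourier 1 (n • M • u) := by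
      rw [fourier_apply, fourier_apply, one_smul, mul_smul, natCast_zsmul, natCast_zsmul]
    rw [e1]
    refine (norm_fourier_one_sub_one_le _).trans ?_
    have h1 : ‖n • M • u‖ ≤ n * ‖M • u‖ := norm_nsmul_le
    have h2 : (n : ℝ) * ‖M • u‖ ≤ M * (ε / M) := by gcongr
    rw [mul_div_cancel₀ _ hM'.ne'] at h2
    gcongr
    linarith
  rw [e, norm_mul, norm_inv, Complex.norm_natCast, inv_mul_le_iff₀ hM']
  refine (norm_sum_le_of_le _ hterm).trans ?_
  simp

/-- The averages of characters along `n N` have no limit in the mean: the product of consecutive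
ones tends to zero, which would force the limit to vanish, while along the scales `N_k` they stay
near `1` on `Γ_ε`. -/
theorem not_cauchy_charAverage {ε : ℝ} (h0 : 0 < ε) (h1 : ε < 1 / (2 * Real.pi))
    {ν : Measure UnitAddCircle} [IsProbabilityMeasure ν] [NullSingletonClass ν]
    {K : Set UnitAddCircle} (hK : K ⊆ gammaSet ε) (hν : ν Kᶜ = 0) :
    ¬ ∀ η : ℝ, 0 < η → ∃ N₀, ∀ M ≥ N₀, ∀ N ≥ N₀,
      ∫ u, ‖charAverage M u - charAverage N u‖ ∂ν ≤ η := by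
  intro hcau
  set δ : ℝ := 1 - 2 * Real.pi * ε with hδ
  have hδ0 : 0 < δ := by
    rw [lt_div_iff₀ (by positivity)] at h1
    linarith
  obtain ⟨N₀, hN₀⟩ := hcau (δ ^ 2 / 4) (by positivity)
  have hbig : ∃ k, 1 ≤ k ∧ N₀ ≤ scaleSeq ε k := by
    have h := (tendsto_inv_scaleSeq h0 h1).eventually
      (gt_mem_nhds (by positivity : 0 < 1 / ((N₀ : ℝ) + 1)))
    obtain ⟨k, hk, hk1⟩ := (h.and (eventually_ge_atTop 1)).exists
    refine ⟨k, hk1, ?_⟩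
    have := lt_of_one_div_lt_one_div (scaleSeq_pos h0 h1 k) hk
    have h2 : (N₀ : ℝ) ≤ scaleSeq ε k := by linarith
    exact_mod_cast h2
  obtain ⟨k, hk1, hkN⟩ := hbig
  set M := scaleSeq ε k
  have hlow : ∀ᵐ u ∂ν, δ ≤ ‖charAverage M u‖ := by
    have : ∀ᵐ u ∂ν, u ∈ K := by rwa [ae_iff]
    filter_upwards [this] with u hu
    have h2 := norm_charAverage_sub_one_le (scaleSeq_succ_lower h0 h1 k).1 (hK hu k hk1)
    have h3 := norm_sub_norm_le (1 : ℂ) (1 - charAverage M u)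
    rw [norm_one, sub_sub_cancel, norm_sub_rev] at h3
    linarith
  have hint : ∀ N N', Integrable (fun u => ‖charAverage N u - charAverage N' u‖) ν := fun N N' =>
    (Integrable.of_bound (C := 1 + 1)
      ((continuous_charAverage N).sub (continuous_charAverage N')).aestronglyMeasurable
      (Eventually.of_forall fun u => (norm_sub_le _ _).trans
        (add_le_add (norm_charAverage_le_one _ _) (norm_charAverage_le_one _ _)))).norm
  have hcp : ∀ N, Continuous fun u => ‖charAverage N u‖ * ‖charAverage (N + 1) u‖ := fun N =>
    (continuous_charAverage N).norm.mul (continuous_charAverage (N + 1)).norm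
  have hbp : ∀ N u, ‖‖charAverage N u‖ * ‖charAverage (N + 1) u‖‖ ≤ 1 := fun N u => by
    rw [norm_mul, norm_norm, norm_norm]
    exact mul_le_one₀ (norm_charAverage_le_one _ _) (norm_nonneg _) (norm_charAverage_le_one _ _)
  have hintp : ∀ N, Integrable (fun u => ‖charAverage N u‖ * ‖charAverage (N + 1) u‖) ν :=
    fun N => Integrable.of_bound (C := 1) (hcp N).aestronglyMeasurable
      (Eventually.of_forall (hbp N))
  have hlim := tendsto_integral_of_dominated_convergence (μ := ν)
    (F := fun N u => ‖charAverage N u‖ * ‖charAverage (N + 1) u‖) (f := fun _ => 0) (fun _ => 1)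
    (fun N => (hcp N).aestronglyMeasurable) (integrable_const 1)
    (fun N => Eventually.of_forall (hbp N)) (by
      have : ∀ᵐ u ∂ν, u ≠ 0 := by
        rw [ae_iff]
        simp
      filter_upwards [this] with u hu
      exact tendsto_charAverage_mul_succ hu)
  rw [integral_zero] at hlim
  have hge : ∀ N ≥ N₀, δ ^ 2 / 2 ≤ ∫ u, ‖charAverage N u‖ * ‖charAverage (N + 1) u‖ ∂ν := by
    intro N hN
    have hp : ∀ᵐ u ∂ν, δ ^ 2 ≤ ‖charAverage N u‖ * ‖charAverage (N + 1) u‖ +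
        (‖charAverage M u - charAverage N u‖ + ‖charAverage M u - charAverage (N + 1) u‖) := by
      filter_upwards [hlow] with u hu
      have t1 := norm_sub_norm_le (charAverage M u) (charAverage N u)
      have t2 := norm_sub_norm_le (charAverage M u) (charAverage (N + 1) u)
      have m1 := norm_charAverage_le_one M u
      have n1 := norm_charAverage_le_one N u
      have n0 := norm_nonneg (charAverage N u)
      have s1 := norm_nonneg (charAverage M u - charAverage N u)
      have s2 := norm_nonneg (charAverage M u - charAverage (N + 1) u)
      set m := ‖charAverage M u‖
      set a := ‖charAverage N u‖
      set b := ‖charAverage (N + 1) u‖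
      have m0 : 0 ≤ m := hδ0.le.trans hu
      calc δ ^ 2 ≤ m ^ 2 := by gcongr
        _ = a * b + (m * (m - a) + a * (m - b)) := by ring
        _ ≤ a * b + (m * ‖charAverage M u - charAverage N u‖ +
            a * ‖charAverage M u - charAverage (N + 1) u‖) := by gcongr
        _ ≤ a * b + (1 * ‖charAverage M u - charAverage N u‖ +
            1 * ‖charAverage M u - charAverage (N + 1) u‖) := by gcongr
        _ = _ := by ring
    have h2 := integral_mono_ae (integrable_const (δ ^ 2))
      ((hintp N).add ((hint M N).add (hint M (N + 1)))) hp
    simp only [integral_const, probReal_univ, one_smul] at h2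
    rw [integral_add' (hintp N) ((hint M N).add (hint M (N + 1))),
      integral_add' (hint M N) (hint M (N + 1))] at h2
    have h3 := hN₀ M hkN N hN
    have h4 := hN₀ M hkN (N + 1) (by omega)
    linarith
  have := ge_of_tendsto hlim (eventually_atTop.2 ⟨N₀, hge⟩)
  have : 0 < δ ^ 2 / 2 := by positivity
  linarith

/-! ### Convergence in `L²` and bounded functions -/

theorem convergesInL2_iff_cauchySeq {X : Type*} [MeasurableSpace X] {μ : Measure X}
    {F : ℕ → X → ℝ} (hF : ∀ N, MemLp (F N) 2 μ) :
    ConvergesInL2 μ F ↔ CauchySeq fun N => (hF N).toLp := by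
  constructor
  · rintro ⟨g, hg, h⟩
    exact ((Lp.tendsto_Lp_iff_tendsto_eLpNorm'' F hF g hg).2 h).cauchySeq
  · intro h
    obtain ⟨G, hG⟩ := cauchySeq_tendsto_of_complete h
    refine ⟨G, Lp.memLp G, ?_⟩
    rw [← Lp.tendsto_Lp_iff_tendsto_eLpNorm'' F hF G (Lp.memLp G), Lp.toLp_coeFn]
    exact hG

section Averages

variable {X : Type*} [MeasurableSpace X] {T : X ≃ᵐ X} {μ : Measure X}

theorem measurePreserving_zpow (hT : MeasurePreserving T μ μ) (m : ℤ) :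
    MeasurePreserving (T.toEquiv ^ m : Equiv.Perm X) μ μ := by
  induction m with
  | zero => simpa using MeasurePreserving.id μ
  | succ n ih =>
    rw [zpow_add_one]
    exact ih.comp hT
  | pred n ih =>
    rw [zpow_sub_one]
    exact ih.comp hT.symm

theorem memLp_arrayAverage (hT : MeasurePreserving T μ μ) (p : ℤ → ℤ → ℤ) {f : X → ℝ}
    (hf : MemLp f 2 μ) (N : ℕ) : MemLp (arrayAverage T p f N) 2 μ :=
  (memLp_finsetSum (Finset.Icc 1 N)
    fun n _ => hf.comp_measurePreserving (measurePreserving_zpow hT (p n N))).const_mul _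

theorem eLpNorm_arrayAverage_le (hT : MeasurePreserving T μ μ) (p : ℤ → ℤ → ℤ) {f : X → ℝ}
    (hf : MemLp f 2 μ) (N : ℕ) : eLpNorm (arrayAverage T p f N) 2 μ ≤ eLpNorm f 2 μ := by
  have e : arrayAverage T p f N = (1 / (N : ℝ)) • ∑ n ∈ Finset.Icc 1 N,
      f ∘ (T.toEquiv ^ (p n N) : Equiv.Perm X) := by
    funext x
    simp [arrayAverage]
  have hc : ∀ n : ℕ, eLpNorm (f ∘ (T.toEquiv ^ (p n N) : Equiv.Perm X)) 2 μ = eLpNorm f 2 μ :=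
    fun n => eLpNorm_comp_measurePreserving hf.1 (measurePreserving_zpow hT _)
  rw [e, eLpNorm_const_smul]
  rcases Nat.eq_zero_or_pos N with rfl | hN
  · simp
  have hs : eLpNorm (∑ n ∈ Finset.Icc 1 N, f ∘ (T.toEquiv ^ (p n N) : Equiv.Perm X)) 2 μ ≤
      N * eLpNorm f 2 μ := by
    refine (eLpNorm_sum_le (fun n _ =>
      (hf.comp_measurePreserving (measurePreserving_zpow hT _)).1) one_le_two).trans ?_
    simp [hc]
  refine (mul_le_mul_right hs _).trans (le_of_eq ?_)
  rw [← mul_assoc, one_div, enorm_inv (by positivity), Real.enorm_natCast,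
    ENNReal.inv_mul_cancel (by simpa using hN.ne') (ENNReal.natCast_ne_top N), one_mul]

theorem arrayAverage_sub (p : ℤ → ℤ → ℤ) (f g : X → ℝ) (N : ℕ) :
    arrayAverage T p (f - g) N = arrayAverage T p f N - arrayAverage T p g N := by
  funext x
  simp [arrayAverage, mul_sub]

theorem arrayAverage_const (p : ℤ → ℤ → ℤ) (c : ℝ) {N : ℕ} (hN : 0 < N) :
    arrayAverage T p (fun _ => c) N = fun _ => c := by
  have : (N : ℝ) ≠ 0 := by exact_mod_cast hN.ne'
  funext x
  simp [arrayAverage, this]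

/-- Since the averages are contractions of `L²`, convergence for a dense class of functions implies
convergence for all; hence a divergent square-integrable example yields a bounded one. -/
theorem exists_bounded_not_convergesInL2 [IsProbabilityMeasure μ] (hT : MeasurePreserving T μ μ)
    (p : ℤ → ℤ → ℤ) {f : X → ℝ} (hf : MemLp f 2 μ)
    (hdiv : ¬ ConvergesInL2 μ (arrayAverage T p f)) :
    ∃ h : X → ℝ, Measurable h ∧ (∃ C : ℝ, ∀ x, |h x| ≤ C) ∧ ∫ x, h x ∂μ = 0 ∧
      ¬ ConvergesInL2 μ (arrayAverage T p h) := by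
  by_contra! hall
  refine hdiv ?_
  rw [convergesInL2_iff_cauchySeq (memLp_arrayAverage hT p hf), Metric.cauchySeq_iff]
  intro δ hδ
  obtain ⟨g, hgf, hg⟩ := hf.exists_simpleFunc_eLpNorm_sub_lt ENNReal.ofNat_ne_top
    (ε := ENNReal.ofReal (δ / 3)) (by simpa using hδ)
  have hgb : ∃ C : ℝ, ∀ x, |g x| ≤ C := g.exists_forall_norm_le
  obtain ⟨C, hC⟩ := hgb
  set c : ℝ := ∫ x, g x ∂μ with hc
  have hcm : MemLp (fun _ : X => c) 2 μ := memLp_const c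
  have hconv := hall (⇑g - fun _ => c) (g.measurable.sub measurable_const)
    ⟨C + |c|, fun x => (abs_sub _ _).trans (by gcongr; exact hC x)⟩ (by
      simp only [Pi.sub_apply]
      rw [integral_sub (hg.integrable one_le_two) (integrable_const c)]
      simp [hc])
  rw [convergesInL2_iff_cauchySeq (memLp_arrayAverage hT p (hg.sub hcm)),
    Metric.cauchySeq_iff] at hconv
  obtain ⟨N₀, hN₀⟩ := hconv (δ / 3) (by positivity)
  have hdist : ∀ {u w : X → ℝ} (hu : MemLp u 2 μ) (hw : MemLp w 2 μ),
      dist hu.toLp hw.toLp = (eLpNorm (u - w) 2 μ).toReal := fun hu hw => by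
    rw [dist_edist, Lp.edist_toLp_toLp]
  have hfg : ∀ N, dist (memLp_arrayAverage hT p hf N).toLp (memLp_arrayAverage hT p hg N).toLp
      < δ / 3 := by
    intro N
    rw [hdist, ← arrayAverage_sub]
    refine (ENNReal.toReal_lt_of_lt_ofReal ?_)
    exact (eLpNorm_arrayAverage_le hT p (hf.sub hg) N).trans_lt hgf
  refine ⟨max N₀ 1, fun M hM N hN => ?_⟩
  have hMN := hN₀ M (le_of_max_le_left hM) N (le_of_max_le_left hN)
  rw [hdist, arrayAverage_sub, arrayAverage_sub, arrayAverage_const p c (le_of_max_le_right hM),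
    arrayAverage_const p c (le_of_max_le_right hN), sub_sub_sub_cancel_right, ← hdist
    (memLp_arrayAverage hT p hg M) (memLp_arrayAverage hT p hg N)] at hMN
  have h1 := hfg M
  have h2 := hfg N
  rw [dist_comm] at h2
  have h3 := dist_triangle4 (memLp_arrayAverage hT p hf M).toLp
    (memLp_arrayAverage hT p hg M).toLp (memLp_arrayAverage hT p hg N).toLp
    (memLp_arrayAverage hT p hf N).toLp
  linarith

end Averages

/-! ### The Gaussian system over a non-atomic measure on `Γ_ε` -/

section CharVectors

variable (ν : Measure UnitAddCircle) [IsProbabilityMeasure ν]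

theorem memLp_fourier (n : ℤ) : MemLp (fun u => (fourier n u : ℂ)) 2 ν :=
  MemLp.of_bound (fourier n).continuous.aestronglyMeasurable 1
    (Eventually.of_forall fun u => (norm_fourier_apply n u).le)

/-- The character `u ↦ e^{2πinu}` as a vector of `L²(ν; ℂ)`, regarded as a real Hilbert space. -/
noncomputable def charVector (n : ℤ) : Lp ℂ 2 ν := (memLp_fourier ν n).toLp

/-- The real inner product of `L²(ν; ℂ)` only sees the real part of the Fourier coefficients. -/
theorem inner_charVector (i j : ℤ) :
    inner ℝ (charVector ν i) (charVector ν j) = (∫ u, fourier (i - j) u ∂ν).re := by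
  rw [L2.inner_def]
  have e : ∀ᵐ u ∂ν, inner ℝ (charVector ν i u) (charVector ν j u) = (fourier (i - j) u : ℂ).re := by
    filter_upwards [(memLp_fourier ν i).coeFn_toLp, (memLp_fourier ν j).coeFn_toLp] with u h1 h2
    rw [charVector, charVector, h1, h2, Complex.inner, ← fourier_neg,
      ← fourier_add, show j + -i = -(i - j) by ring, fourier_neg, Complex.conj_re]
  rw [integral_congr_ae e]
  exact integral_re (integrable_fourier (i - j))

/-- The coefficients of the average along `n N`, as a finitely supported function of the time. -/
noncomputable def averageCoeff (N : ℕ) : ℤ →₀ ℝ :=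
  ∑ n ∈ Finset.Icc 1 N, Finsupp.single ((n : ℤ) * N) ((N : ℝ)⁻¹)

theorem arrayAverage_intShift (N : ℕ) (x : ℤ → ℝ) :
    arrayAverage intShift (fun n N => n * N) (fun x => x 0) N x =
      Finsupp.linearCombination ℝ x (averageCoeff N) := by
  rw [arrayAverage, averageCoeff, map_sum, Finset.mul_sum]
  refine Finset.sum_congr rfl fun n _ => ?_
  rw [Finsupp.linearCombination_single, intShift_zpow_apply, zero_add, smul_eq_mul, one_div]

theorem coeFn_linearCombination_averageCoeff (N : ℕ) :
    (Finsupp.linearCombination ℝ (charVector ν) (averageCoeff N) : UnitAddCircle → ℂ) =ᵐ[ν]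
      charAverage N := by
  filter_upwards [coeFn_linearCombination (charVector ν) (averageCoeff N),
    ae_all_iff.2 fun n => (memLp_fourier ν n).coeFn_toLp] with u h1 h2
  rw [h1, averageCoeff, map_sum, charAverage, Finset.mul_sum]
  refine Finset.sum_congr rfl fun n _ => ?_
  rw [Finsupp.linearCombination_single, charVector, h2, Complex.real_smul]
  push_cast
  rfl

/-- The passage from `L²(ν)` to `L¹(ν)`, where the divergence of the averages is detected. -/
theorem integral_norm_charAverage_sub_le (M N : ℕ) :
    ∫ u, ‖charAverage M u - charAverage N u‖ ∂ν ≤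
      ‖Finsupp.linearCombination ℝ (charVector ν) (averageCoeff M - averageCoeff N)‖ := by
  rw [map_sub]
  set P := Finsupp.linearCombination ℝ (charVector ν) (averageCoeff M) with hP
  set Q := Finsupp.linearCombination ℝ (charVector ν) (averageCoeff N) with hQ
  have hae : (P - Q : Lp ℂ 2 ν) =ᵐ[ν] fun u => charAverage M u - charAverage N u := by
    filter_upwards [Lp.coeFn_sub P Q, coeFn_linearCombination_averageCoeff ν M,
      coeFn_linearCombination_averageCoeff ν N] with u h1 h2 h3
    rw [h1, Pi.sub_apply, h2, h3]
  have hm : AEStronglyMeasurable (fun u => charAverage M u - charAverage N u) ν :=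
    ((continuous_charAverage M).sub (continuous_charAverage N)).aestronglyMeasurable
  rw [integral_norm_eq_lintegral_enorm hm, ← eLpNorm_one_eq_lintegral_enorm, Lp.norm_def,
    eLpNorm_congr_ae hae]
  refine ENNReal.toReal_mono ?_ (eLpNorm_le_eLpNorm_of_exponent_le one_le_two hm)
  rw [← eLpNorm_congr_ae hae]
  exact (Lp.memLp _).2.ne

end CharVectors

section GaussianMoments

variable {ι H : Type*} [NormedAddCommGroup H] [InnerProductSpace ℝ H] {μ : Measure (ι → ℝ)}
  {v : ι → H}

theorem IsGaussianWithCovariance.memLp (hμ : IsGaussianWithCovariance μ v) (a : ι →₀ ℝ) :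
    MemLp (fun x => Finsupp.linearCombination ℝ x a) 2 μ := by
  have h := ProbabilityTheory.memLp_id_gaussianReal (μ := 0)
    (v := ‖Finsupp.linearCombination ℝ v a‖₊ ^ 2) 2
  rw [← hμ a] at h
  exact (memLp_map_measure_iff aestronglyMeasurable_id
    (measurable_linearCombination a).aemeasurable).1 h

theorem IsGaussianWithCovariance.integral_eq_zero (hμ : IsGaussianWithCovariance μ v)
    (a : ι →₀ ℝ) : ∫ x, Finsupp.linearCombination ℝ x a ∂μ = 0 := by
  have h := integral_map (μ := μ) (measurable_linearCombination a).aemeasurable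
    (f := fun t : ℝ => t) aestronglyMeasurable_id
  rw [← h, hμ a, ProbabilityTheory.integral_id_gaussianReal]

theorem IsGaussianWithCovariance.integral_sq (hμ : IsGaussianWithCovariance μ v) (a : ι →₀ ℝ) :
    ∫ x, Finsupp.linearCombination ℝ x a ^ 2 ∂μ = ‖Finsupp.linearCombination ℝ v a‖ ^ 2 := by
  have h := integral_map (μ := μ) (measurable_linearCombination a).aemeasurable
    (f := fun t : ℝ => t ^ 2) (by fun_prop)
  have hv := ProbabilityTheory.variance_id_gaussianReal (μ := 0)
    (v := ‖Finsupp.linearCombination ℝ v a‖₊ ^ 2)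
  rw [ProbabilityTheory.variance_eq_integral aemeasurable_id] at hv
  simp only [id, ProbabilityTheory.integral_id_gaussianReal, sub_zero] at hv
  rw [← h, hμ a, hv]
  simp

theorem IsGaussianWithCovariance.integral_mul (hμ : IsGaussianWithCovariance μ v)
    (a b : ι →₀ ℝ) :
    ∫ x, Finsupp.linearCombination ℝ x a * Finsupp.linearCombination ℝ x b ∂μ =
      inner ℝ (Finsupp.linearCombination ℝ v a) (Finsupp.linearCombination ℝ v b) := by
  have e : ∀ x : ι → ℝ, Finsupp.linearCombination ℝ x a * Finsupp.linearCombination ℝ x b =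
      (Finsupp.linearCombination ℝ x (a + b) ^ 2 -
        Finsupp.linearCombination ℝ x (a - b) ^ 2) / 4 := by
    intro x
    rw [map_add, map_sub]
    ring
  simp only [e]
  rw [integral_div, integral_sub (hμ.memLp (a + b)).integrable_sq (hμ.memLp (a - b)).integrable_sq,
    hμ.integral_sq, hμ.integral_sq, map_add, map_sub, norm_add_sq_real, norm_sub_sq_real]
  ring

/-- Sending a coordinate to the corresponding vector of `H` is an isometry for the `L²(μ)` norm. -/
theorem IsGaussianWithCovariance.norm_toLp (hμ : IsGaussianWithCovariance μ v) (a : ι →₀ ℝ) :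
    ‖(hμ.memLp a).toLp‖ = ‖Finsupp.linearCombination ℝ v a‖ := by
  rw [← sq_eq_sq₀ (norm_nonneg _) (norm_nonneg _), ← hμ.integral_sq, ← real_inner_self_eq_norm_sq,
    L2.inner_def]
  refine integral_congr_ae ?_
  filter_upwards [(hμ.memLp a).coeFn_toLp] with x hx
  rw [hx]
  simp [sq]

end GaussianMoments

theorem integral_fourier_im_eq_zero {ν : Measure UnitAddCircle}
    (hsym : ν.map (fun u => -u) = ν) (n : ℤ) : (∫ u, fourier n u ∂ν).im = 0 := by
  rw [← Complex.conj_eq_iff_im, conj_integral_fourier]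
  conv_rhs => rw [← hsym]
  rw [integral_map measurable_neg.aemeasurable (fourier n).continuous.aestronglyMeasurable]
  refine integral_congr_ae (Eventually.of_forall fun u => ?_)
  simp only [fourier_apply, smul_neg, neg_smul]

/-- The witness for the unbounded example: `f` is the zeroth coordinate of the stationary Gaussian
process whose spectral measure is a symmetric non-atomic measure on a Cantor subset of `Γ_ε`. -/
theorem exists_weaklyMixing_divergent {ε : ℝ} (h0 : 0 < ε) (h1 : ε < 1 / (2 * Real.pi)) :
    ∃ μ : Measure (ℤ → ℝ), IsProbabilityMeasure μ ∧ IsWeaklyMixing intShift μ ∧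
      ∃ (K : Set UnitAddCircle) (ν : Measure UnitAddCircle) (f : (ℤ → ℝ) → ℝ),
        IsCantorLike K ∧ K ⊆ gammaSet ε ∧
        IsProbabilityMeasure ν ∧ NullSingletonClass ν ∧ ν Kᶜ = 0 ∧
        Measurable f ∧ MemLp f 2 μ ∧ ∫ x, f x ∂μ = 0 ∧
        IsSpectralMeasure intShift μ f ν ∧
        ¬ ConvergesInL2 μ (arrayAverage intShift (fun n N => n * N) f) := by
  obtain ⟨K, ν, hK, hKΓ, hν, hna, hνK, hsym⟩ := exists_symmetric_measure_on_cantorLike h0 h1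
  obtain ⟨μ, hμp, hμ⟩ := exists_gaussian_measure (charVector ν)
  obtain ⟨n, hn⟩ := exists_tendsto_integral_fourier (ν := ν)
  have hwm : IsWeaklyMixing intShift μ :=
    isWeaklyMixing_intShift (c := fun m => (∫ u, fourier m u ∂ν).re) hμ (inner_charVector ν)
      (l := atTop) (n := n) fun j => (Complex.continuous_re.tendsto 0).comp (hn j)
  have hcoord : ∀ i : ℤ, (fun x : ℤ → ℝ => x i) =
      fun x => Finsupp.linearCombination ℝ x (Finsupp.single i 1) := fun i => by
    funext x
    simp
  have hmem : MemLp (fun x : ℤ → ℝ => x 0) 2 μ := by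
    rw [hcoord]
    exact hμ.memLp _
  refine ⟨μ, hμp, hwm, K, ν, fun x => x 0, hK, hKΓ, hν, hna, hνK, measurable_pi_apply 0, hmem, ?_,
    ⟨inferInstance, fun m => ?_⟩, fun hconv => ?_⟩
  · rw [hcoord]
    exact hμ.integral_eq_zero _
  · have h := hμ.integral_mul (Finsupp.single m 1) (Finsupp.single 0 1)
    simp only [Finsupp.linearCombination_single, one_smul, inner_charVector, sub_zero] at h
    simp only [intShift_zpow_apply, zero_add]
    rw [h]
    exact Complex.ext rfl (integral_fourier_im_eq_zero hsym m)
  · refine not_cauchy_charAverage h0 h1 hKΓ hνK fun η hη => ?_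
    have hmemA : ∀ N, MemLp (arrayAverage intShift (fun n N => n * N) (fun x => x 0) N) 2 μ :=
      memLp_arrayAverage hwm.1 _ hmem
    rw [convergesInL2_iff_cauchySeq hmemA, Metric.cauchySeq_iff] at hconv
    obtain ⟨N₀, hN₀⟩ := hconv η hη
    refine ⟨N₀, fun M hM N hN => (integral_norm_charAverage_sub_le ν M N).trans ?_⟩
    refine le_trans (le_of_eq ?_) (hN₀ M hM N hN).le
    rw [← hμ.norm_toLp, dist_eq_norm, ← MemLp.toLp_sub]
    congr 1
    refine MemLp.toLp_congr _ _ (Eventually.of_forall fun x => ?_)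
    simp only [map_sub]
    rw [Pi.sub_apply, arrayAverage_intShift, arrayAverage_intShift]

theorem mainTheorem9 :
    (∀ ε : ℝ, 0 < ε → ε < 1 / (2 * Real.pi) →
      ∃ (X : Type) (_ : MeasurableSpace X) (_ : StandardBorelSpace X) (μ : Measure X)
        (_ : IsProbabilityMeasure μ) (T : X ≃ᵐ X),
        IsWeaklyMixing T μ ∧
        (∃ (K : Set UnitAddCircle) (ν : Measure UnitAddCircle) (f : X → ℝ),
          IsCantorLike K ∧ K ⊆ gammaSet ε ∧
          IsProbabilityMeasure ν ∧ NullSingletonClass ν ∧ ν Kᶜ = 0 ∧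
          Measurable f ∧ MemLp f 2 μ ∧ ∫ x, f x ∂μ = 0 ∧
          IsSpectralMeasure T μ f ν ∧
          ¬ ConvergesInL2 μ (arrayAverage T (fun n N => n * N) f)) ∧
        (∃ f : X → ℝ, Measurable f ∧ (∃ C : ℝ, ∀ x, |f x| ≤ C) ∧ ∫ x, f x ∂μ = 0 ∧
          ¬ ConvergesInL2 μ (arrayAverage T (fun n N => n * N) f))) ∧
    ¬ WeakMixingSufficesForPolynomials := by
  have main : ∀ ε : ℝ, 0 < ε → ε < 1 / (2 * Real.pi) →
      ∃ μ : Measure (ℤ → ℝ), IsProbabilityMeasure μ ∧ IsWeaklyMixing intShift μ ∧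
        (∃ (K : Set UnitAddCircle) (ν : Measure UnitAddCircle) (f : (ℤ → ℝ) → ℝ),
          IsCantorLike K ∧ K ⊆ gammaSet ε ∧
          IsProbabilityMeasure ν ∧ NullSingletonClass ν ∧ ν Kᶜ = 0 ∧
          Measurable f ∧ MemLp f 2 μ ∧ ∫ x, f x ∂μ = 0 ∧
          IsSpectralMeasure intShift μ f ν ∧
          ¬ ConvergesInL2 μ (arrayAverage intShift (fun n N => n * N) f)) ∧
        (∃ f : (ℤ → ℝ) → ℝ, Measurable f ∧ (∃ C : ℝ, ∀ x, |f x| ≤ C) ∧ ∫ x, f x ∂μ = 0 ∧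
          ¬ ConvergesInL2 μ (arrayAverage intShift (fun n N => n * N) f)) := by
    intro ε h0 h1
    obtain ⟨μ, hp, hwm, hex⟩ := exists_weaklyMixing_divergent h0 h1
    refine ⟨μ, hp, hwm, hex, ?_⟩
    obtain ⟨-, -, f, -, -, -, -, -, -, hf, -, -, hdiv⟩ := hex
    exact exists_bounded_not_convergesInL2 hwm.1 _ hf hdiv
  refine ⟨fun ε h0 h1 => ?_, fun hall => ?_⟩
  · obtain ⟨μ, hp, h⟩ := main ε h0 h1
    exact ⟨ℤ → ℝ, inferInstance, inferInstance, μ, hp, intShift, h⟩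
  · have hpos : 0 < 1 / (2 * Real.pi) := by positivity
    obtain ⟨μ, hp, hwm, -, f, hfm, hfb, -, hdiv⟩ :=
      main (1 / (2 * Real.pi) / 2) (by positivity) (half_lt_self hpos)
    refine hdiv (hall (ℤ → ℝ) inferInstance inferInstance μ hp intShift hwm (fun n N => n * N)
      ⟨MvPolynomial.X 0 * MvPolynomial.X 1, fun n N => by simp⟩ ⟨0, 1, 1, by norm_num⟩ f hfm hfb)
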